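/- Let $\Sigma$ be a finite linearly ordered alphabet with $k$ symbols; identify $\Sigma$ with $\{0<1<\dots<k-1\}$. A necklace of length $n$ is a class of words of length $n$ over $\Sigma$ under rotation; its representative is the lexicographically smallest word of the class; it is palindromic if it equals the class of the reversals of its words. For a word $v\in\Sigma^n$ let $RP(v)$, the rank of $v$ among the palindromic necklaces, be the number of palindromic necklaces of length $n$ whose representative is lexicographically smaller than $v$. **Theorem.** $RP(v)$ can be computed in $O(k\cdot n^3\cdot\log^2 n)$ time. Precisely: there are one program $P$ for a random access machine and one constant $C$ such that for all $k$, all $n\ge 1$ and all words $v\in\Sigma^n$ (not necessarily representatives), $P$, started on the input $n,k,v_1,\dots,v_n$ (with all other registers $0$), halts with the output $RP(v)$ after at most $C\cdot k\cdot n^3\cdot(1+\log n)^2$ steps. Here the registers of the machine hold natural numbers; its instructions (load a constant, copy, $+$, truncated $-$, $\times$, integer division, indirect load, indirect store, jump, and jump if one register is less than another) cost one step each, and throughout the computation every register holds a number of at most $((n+1)k^n)^C$, that is, of $O(n\log k+\log n)$ bits. -/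

import Mathlib

/-! ### Words and necklaces

Words over `α` are lists, ordered lexicographically (the order of `List α`); a necklace is a
class of words under rotation, i.e. an element of `Cycle α`. -/

/-- `w` is the representative of the necklace `c`: the lexicographically smallest word in the
class `c`. -/
def IsNecklaceRep {α : Type*} [LinearOrder α] (c : Cycle α) (w : List α) : Prop :=
  IsLeast {u : List α | (u : Cycle α) = c} w

/-- A necklace is palindromic if it is equal to its reversal (the class of the reversals of its
words). -/
def IsPalindromicNecklace {α : Type*} (c : Cycle α) : Prop :=
  c.reverse = c

/-- The representatives of the palindromic necklaces of length `n`. -/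
def palindromicNecklaceReps (α : Type*) [LinearOrder α] (n : ℕ) : Set (List α) :=
  {w | ∃ c : Cycle α, c.length = n ∧ IsPalindromicNecklace c ∧ IsNecklaceRep c w}

/-- The rank of a word `v` with respect to a set `S` of words: the number of words of `S` that are
smaller than `v`. -/
noncomputable def wordRank {α : Type*} [LinearOrder α] (S : Set (List α)) (v : List α) : ℕ :=
  {w ∈ S | w < v}.ncard

/-- The rank of a word among the palindromic necklaces of its length. -/
noncomputable def RP {α : Type*} [LinearOrder α] (v : List α) : ℕ :=
  wordRank (palindromicNecklaceReps α v.length) v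

/-! ### Random access machines with unit cost -/

namespace RAM

/-- The instructions of a random access machine whose registers `R[0], R[1], …` hold natural
numbers. -/
inductive Instr : Type
  /-- `R[d] := c` -/
  | const (d c : ℕ)
  /-- `R[d] := R[a]` -/
  | copy (d a : ℕ)
  /-- `R[d] := R[a] + R[b]` -/
  | add (d a b : ℕ)
  /-- `R[d] := max (R[a] - R[b]) 0` -/
  | sub (d a b : ℕ)
  /-- `R[d] := R[a] * R[b]` -/
  | mul (d a b : ℕ)
  /-- `R[d] := ⌊R[a] / R[b]⌋` (`0` if `R[b] = 0`) -/
  | div (d a b : ℕ)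
  /-- `R[d] := R[R[a]]` -/
  | load (d a : ℕ)
  /-- `R[R[d]] := R[a]` -/
  | store (d a : ℕ)
  /-- continue at instruction number `l` -/
  | jump (l : ℕ)
  /-- if `R[a] < R[b]`, continue at instruction number `l` -/
  | jumpLt (a b l : ℕ)

/-- A program is a finite list of instructions, numbered from `0`. -/
abbrev Program : Type := List Instr

/-- A configuration: the number of the next instruction and the contents of the registers. -/
structure Config : Type where
  pc : ℕ
  mem : ℕ → ℕ

/-- The effect of one instruction. -/
def Instr.exec : Instr → Config → Config
  | .const d c, s => ⟨s.pc + 1, Function.update s.mem d c⟩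
  | .copy d a, s => ⟨s.pc + 1, Function.update s.mem d (s.mem a)⟩
  | .add d a b, s => ⟨s.pc + 1, Function.update s.mem d (s.mem a + s.mem b)⟩
  | .sub d a b, s => ⟨s.pc + 1, Function.update s.mem d (s.mem a - s.mem b)⟩
  | .mul d a b, s => ⟨s.pc + 1, Function.update s.mem d (s.mem a * s.mem b)⟩
  | .div d a b, s => ⟨s.pc + 1, Function.update s.mem d (s.mem a / s.mem b)⟩
  | .load d a, s => ⟨s.pc + 1, Function.update s.mem d (s.mem (s.mem a))⟩
  | .store d a, s => ⟨s.pc + 1, Function.update s.mem (s.mem d) (s.mem a)⟩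
  | .jump l, s => ⟨l, s.mem⟩
  | .jumpLt a b l, s => ⟨if s.mem a < s.mem b then l else s.pc + 1, s.mem⟩

/-- The machine has halted when there is no instruction with number `pc`. -/
def Halted (P : Program) (s : Config) : Prop := P.length ≤ s.pc

/-- One step of the machine; every instruction costs one step. A halted machine stays put. -/
def step (P : Program) (s : Config) : Config :=
  match P[s.pc]? with
  | some i => i.exec s
  | none => s

/-- The configuration after `t` steps, started at instruction `0` on the memory `m`. -/
def run (P : Program) (m : ℕ → ℕ) (t : ℕ) : Config := (step P)^[t] ⟨0, m⟩

/-- Started on the memory `m`, the program `P` halts after at most `t` steps with the number `out`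
in register `0`, and no register ever holds a number larger than `B`. -/
def ComputesWithin (P : Program) (m : ℕ → ℕ) (out t B : ℕ) : Prop :=
  Halted P (run P m t) ∧ (run P m t).mem 0 = out ∧ ∀ s a : ℕ, (run P m s).mem a ≤ B

/-- The input memory for a word `v` over the alphabet `{0 < 1 < ⋯ < k - 1}`: register `0` holds the
length of `v`, register `1` holds `k`, the following registers hold the symbols of `v` in order, and
all other registers hold `0`. -/
def inputMem {k : ℕ} (v : List (Fin k)) : ℕ → ℕ
  | 0 => v.length
  | 1 => k
  | i + 2 => ((v[i]?).map Fin.val).getD 0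

end RAM

/-!
The proof turns the rank into a number of closed walks in a finite automaton and counts these walks
by dynamic programming on a random access machine.

*From necklaces to palindromes.* On the rotations of a word `w` of length `n`, the two reflections
`w ↦ wᴿ` and `a p ↦ a pᴿ` together have exactly two fixed points, counted with multiplicity, if the
necklace of `w` is palindromic, and none otherwise (`card_fixed_rotations`). Since a palindromic
necklace is counted by `RP v` if and only if one of its words is smaller than `v`, the number
`2 * RP v` counts the palindromes `w` of length `n`, and the words `a p` of length `n` with a
palindrome `p`, that have a rotation smaller than `v` (`two_mul_RP`).

*From palindromes to closed walks.* A rotation of `w` is smaller than `v`, for words of the same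
length `n`, if and only if `w w` contains a proper prefix of `v` followed by a letter smaller than
the next letter of `v`. The automaton that looks for such factors has as its states the lengths of
the proper prefixes of `v`, and one dead state `n`; its transitions satisfy the recursion of Knuth,
Morris and Pratt (`stateOf_take_concat`). A word `w` of length `n` without a rotation below `v`
labels exactly one closed walk through the live states, and any other word labels none
(`sum_closed_walks`). At the dead state every word labels a closed walk. Hence `2 * RP v` is the
number of closed walks at the dead state minus the number of those at the live states, where the
labels are the words of the two kinds above (`two_mul_RP_add_sum_closedWalkCount`).

*Counting.* A palindrome of length `l + 2` is `a q a` with a palindrome `q` of length `l`, so the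
numbers of walks along palindromes of length `l + 2` from `t` to `s` come from those of length `l`
by running through all triples of a start `t`, a letter `a` and the state `s'` in which the last `a`
is read (`walkCount`). For each of the `n` lengths this takes `O(k * n ^ 2)` operations, which gives
`O(k * n ^ 3)` in total; all intermediate numbers are at most `2 * (n + 1) * k ^ n`.

*The machine.* The algorithm is written in a small language with loops, branches and a
three-dimensional array (`mainCmd`), where its correctness and its cost are proved with the rules
for `Meets`. The language is translated to machine instructions, and the translation is correct step
by step, with the same cost and with all registers bounded (`Cmd.simulation`). The array is stored
at the addresses `(x * M + y) * M + z` with `M = 32 * n`. The input occupies the low registers,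
which are needed for the variables, so a first block of instructions moves it away (`relocation`).
-/

/-! ### Counting palindromic necklaces by palindromes -/

/-- The palindromes of length `l` over the finite alphabet `α`. -/
def palindromes (α : Type*) [Fintype α] [DecidableEq α] : ℕ → Finset (List α)
  | 0 => {[]}
  | 1 => Finset.univ.image fun a => [a]
  | l + 2 => (Finset.univ ×ˢ palindromes α l).image fun x => x.1 :: (x.2 ++ [x.1])

/-- The words of length `n ≥ 1` that become a palindrome when their first letter is removed. -/
def tailPalindromes (α : Type*) [Fintype α] [DecidableEq α] (n : ℕ) : Finset (List α) :=
  (Finset.univ ×ˢ palindromes α (n - 1)).image fun x => x.1 :: x.2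

section Palindromes

variable {α : Type*} [Fintype α] [DecidableEq α]

theorem mem_palindromes {l : ℕ} {w : List α} :
    w ∈ palindromes α l ↔ w.length = l ∧ w.reverse = w := by
  rw [← List.Palindrome.iff_reverse_eq]
  constructor
  · intro h
    induction l using Nat.twoStepInduction generalizing w with
    | zero => simp only [palindromes, Finset.mem_singleton] at h; subst h; exact ⟨rfl, .nil⟩
    | one =>
      simp only [palindromes, Finset.mem_image, Finset.mem_univ, true_and] at h
      obtain ⟨a, rfl⟩ := h
      exact ⟨rfl, .singleton a⟩
    | more l ih _ =>
      simp only [palindromes, Finset.mem_image, Finset.mem_product, Finset.mem_univ,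
        true_and] at h
      obtain ⟨⟨a, q⟩, hq, rfl⟩ := h
      obtain ⟨h1, h2⟩ := ih hq
      exact ⟨by simp at h1; simp [h1], .cons_concat a h2⟩
  · rintro ⟨h, hp⟩
    induction hp generalizing l with
    | nil => subst h; simp [palindromes]
    | singleton a => subst h; simp [palindromes]
    | cons_concat a hq ih =>
      subst h
      simp only [List.length_cons, List.length_append, List.length_nil, zero_add, palindromes,
        Finset.mem_image, Finset.mem_product, Finset.mem_univ, true_and]
      exact ⟨(a, _), ih rfl, rfl⟩

theorem mem_tailPalindromes {n : ℕ} (hn : 1 ≤ n) {w : List α} :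
    w ∈ tailPalindromes α n ↔ w.length = n ∧ w.reverse = w.rotate 1 := by
  obtain ⟨m, rfl⟩ := Nat.exists_eq_add_of_le' hn
  cases w with
  | nil => simp [tailPalindromes]
  | cons a p =>
    simp [tailPalindromes, mem_palindromes]

theorem card_palindromes_le (l : ℕ) : (palindromes α l).card ≤ Fintype.card α ^ l := by
  induction l using Nat.twoStepInduction with
  | zero => simp [palindromes]
  | one => simpa [palindromes] using Finset.card_image_le (s := Finset.univ) (f := fun a : α => [a])
  | more l ih _ =>
    rw [palindromes]
    refine Finset.card_image_le.trans ?_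
    rw [Finset.card_product, Finset.card_univ]
    rcases Nat.eq_zero_or_pos (Fintype.card α) with h | h
    · simp [h]
    · rw [pow_succ']
      exact Nat.mul_le_mul_left _ (ih.trans (Nat.pow_le_pow_right h (by omega)))

end Palindromes

section Rotations

variable {α : Type*}

open scoped List

/-- Rotating a rotation of a word back after reversing it. -/
theorem rotate_reverse_rotate (w : List α) (i : ℕ) :
    (w.rotate i).reverse.rotate i = w.reverse := by
  rw [List.reverse_rotate, List.rotate_rotate]
  rcases Nat.eq_zero_or_pos w.length with h | h
  · simp [List.length_eq_zero_iff.1 h]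
  · rw [← List.rotate_mod, List.length_reverse]
    have h1 : i % w.length < w.length := Nat.mod_lt _ h
    have h2 : (w.length - i % w.length + i) % w.length = 0 := by
      have h3 := Nat.div_add_mod i w.length
      have : w.length - i % w.length + i = w.length * (i / w.length + 1) := by
        rw [mul_add]; omega
      rw [this, Nat.mul_mod_right]
    rw [h2, List.rotate_zero]

/-- The number of distinct rotations of `w`. -/
noncomputable def rotationPeriod (w : List α) : ℕ :=
  Function.minimalPeriod (fun u : List α => u.rotate 1) w

theorem iterate_rotate_one (w : List α) (i : ℕ) :
    (fun u : List α => u.rotate 1)^[i] w = w.rotate i := by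
  induction i with
  | zero => simp
  | succ i ih => rw [Function.iterate_succ_apply', ih, List.rotate_rotate]

theorem rotate_mod_rotationPeriod (w : List α) (i : ℕ) :
    w.rotate (i % rotationPeriod w) = w.rotate i := by
  rw [← iterate_rotate_one, ← iterate_rotate_one, rotationPeriod,
    Function.iterate_mod_minimalPeriod_eq]

theorem rotationPeriod_pos {w : List α} (hw : w ≠ []) : 0 < rotationPeriod w := by
  refine Function.IsPeriodicPt.minimalPeriod_pos (n := w.length) (List.length_pos_iff.2 hw) ?_
  rw [Function.IsPeriodicPt, Function.IsFixedPt, iterate_rotate_one, List.rotate_length]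

theorem rotate_eq_rotate_iff {w : List α} (hw : w ≠ []) (i j : ℕ) :
    w.rotate i = w.rotate j ↔ i ≡ j [MOD rotationPeriod w] := by
  rw [← rotate_mod_rotationPeriod w i, ← rotate_mod_rotationPeriod w j, ← iterate_rotate_one,
    ← iterate_rotate_one]
  exact Function.iterate_eq_iterate_iff_of_lt_minimalPeriod
    (Nat.mod_lt _ (rotationPeriod_pos hw)) (Nat.mod_lt _ (rotationPeriod_pos hw))

/-- Among the doubled indices `2 * i` and `2 * i + 1` with `i < d`, each residue modulo `d` occurs
exactly twice. -/
theorem card_filter_double_modEq (d r : ℕ) (hd : 0 < d) :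
    ((Finset.range d).filter fun i => r ≡ 2 * i [MOD d]).card +
      ((Finset.range d).filter fun i => r ≡ 2 * i + 1 [MOD d]).card = 2 := by
  have key : ∀ (f : ℕ → Prop) [DecidablePred f] (d : ℕ),
      ((Finset.range d).filter fun i => f (2 * i)).card +
      ((Finset.range d).filter fun i => f (2 * i + 1)).card =
      ((Finset.range (2 * d)).filter f).card := by
    intro f _ d
    simp only [Finset.card_filter]
    induction d with
    | zero => simp
    | succ d ih =>
      rw [show 2 * (d + 1) = 2 * d + 1 + 1 by ring, Finset.sum_range_succ, Finset.sum_range_succ,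
        Finset.sum_range_succ, Finset.sum_range_succ, ← ih]
      ring
  rw [key (fun j => r ≡ j [MOD d]) d]
  have h : (Finset.range (2 * d)).filter (fun j => r ≡ j [MOD d]) =
      ({r % d, r % d + d} : Finset ℕ) := by
    have hr := Nat.mod_lt r hd
    ext j
    rw [Finset.mem_filter, Finset.mem_range, Finset.mem_insert, Finset.mem_singleton, Nat.ModEq]
    constructor
    · rintro ⟨h1, h2⟩
      rcases lt_or_ge j d with h | h
      · left; rw [h2, Nat.mod_eq_of_lt h]
      · right
        have : j % d = j - d := by rw [Nat.mod_eq_sub_mod h, Nat.mod_eq_of_lt (by omega)]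
        omega
    · rintro (rfl | rfl)
      · exact ⟨by omega, (Nat.mod_mod _ _).symm⟩
      · exact ⟨by omega, by simp⟩
  rw [h, Finset.card_pair (by omega)]

/-- The words of a palindromic necklace that are fixed by one of the two reflections `w ↦ wᴿ` and
`a p ↦ a pᴿ`: there are two, counted with multiplicity. The reversal of the `i`-th rotation of `w`
is the `(r - i)`-th one for some `r`, so the fixed words are given by `2 * i ≡ r` and
`2 * i + 1 ≡ r`. -/
theorem card_fixed_rotations [Fintype α] [DecidableEq α] {w : List α} (hw : w ≠ [])
    (h : w.reverse ~r w) :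
    ((palindromes α w.length).filter (· ~r w)).card +
      ((tailPalindromes α w.length).filter (· ~r w)).card = 2 := by
  obtain ⟨r, hr⟩ := h.symm
  rw [← card_filter_double_modEq (rotationPeriod w) r (rotationPeriod_pos hw)]
  have aux : ∀ (A : Finset (List α)) (e : ℕ),
      (∀ u, u ∈ A ↔ u.length = w.length ∧ u.reverse = u.rotate e) →
      (A.filter (· ~r w)).card =
        ((Finset.range (rotationPeriod w)).filter
          fun i => r ≡ 2 * i + e [MOD rotationPeriod w]).card := by
    intro A e hA
    have fix : ∀ i, w.rotate i ∈ A ↔ r ≡ 2 * i + e [MOD rotationPeriod w] := by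
      intro i
      rw [hA, ← rotate_eq_rotate_iff hw, hr, ← rotate_reverse_rotate w i,
        show 2 * i + e = i + e + i by ring, ← List.rotate_rotate, ← List.rotate_rotate,
        List.rotate_eq_rotate]
      simp
    symm
    apply Finset.card_bij (fun i _ => w.rotate i)
    · intro i hi
      rw [Finset.mem_filter, Finset.mem_range] at hi
      rw [Finset.mem_filter]
      exact ⟨(fix i).2 hi.2, List.IsRotated.forall w i⟩
    · intro i hi j hj hij
      rw [Finset.mem_filter, Finset.mem_range] at hi hj
      have := (rotate_eq_rotate_iff hw i j).1 hij
      rwa [Nat.ModEq, Nat.mod_eq_of_lt hi.1, Nat.mod_eq_of_lt hj.1] at this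
    · intro u hu
      rw [Finset.mem_filter] at hu
      obtain ⟨i, rfl⟩ := hu.2.symm
      refine ⟨i % rotationPeriod w, ?_, rotate_mod_rotationPeriod w i⟩
      rw [Finset.mem_filter, Finset.mem_range, ← fix, rotate_mod_rotationPeriod]
      exact ⟨Nat.mod_lt _ (rotationPeriod_pos hw), hu.1⟩
  rw [aux _ 0 fun u => by rw [mem_palindromes, List.rotate_zero],
    aux _ 1 fun u => mem_tailPalindromes (List.length_pos_iff.2 hw)]
  simp

end Rotations

section Rank

open scoped List

variable {α : Type*} [LinearOrder α]

theorem mem_palindromicNecklaceReps {n : ℕ} {w : List α} :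
    w ∈ palindromicNecklaceReps α n ↔
      w.length = n ∧ w.reverse ~r w ∧ ∀ u, u ~r w → w ≤ u := by
  simp only [palindromicNecklaceReps, IsPalindromicNecklace, IsNecklaceRep, IsLeast,
    Set.mem_ofPred_eq, mem_lowerBounds]
  constructor
  · rintro ⟨c, h1, h2, rfl, h3⟩
    exact ⟨h1, Cycle.coe_eq_coe.1 h2, fun u hu => h3 u (Cycle.coe_eq_coe.2 hu)⟩
  · rintro ⟨h1, h2, h3⟩
    exact ⟨w, h1, Cycle.coe_eq_coe.2 h2, rfl, fun u hu => h3 u (Cycle.coe_eq_coe.1 hu)⟩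

open scoped Classical in
/-- Twice the rank of `v` among the palindromic necklaces is the number of words that are fixed by
one of the two reflections and have a rotation smaller than `v`. -/
theorem two_mul_RP [Fintype α] {v : List α} (hv : v ≠ []) :
    2 * RP v =
      ((palindromes α v.length).filter fun w => ∃ u, u ~r w ∧ u < v).card +
      ((tailPalindromes α v.length).filter fun w => ∃ u, u ~r w ∧ u < v).card := by
  have hfin : {w ∈ palindromicNecklaceReps α v.length | w < v}.Finite :=
    (List.finite_length_eq α v.length).subset fun w hw => (mem_palindromicNecklaceReps.1 hw.1).1
  have aux : ∀ (A : Finset (List α)) (e : ℕ),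
      (∀ u, u ∈ A ↔ u.length = v.length ∧ u.reverse = u.rotate e) →
      (A.filter fun w => ∃ u, u ~r w ∧ u < v).card =
        ∑ b ∈ hfin.toFinset, (A.filter (· ~r b)).card := by
    intro A e hA
    rw [← Finset.card_biUnion]
    · congr 1
      ext w
      simp only [Finset.mem_filter, Finset.mem_biUnion, Set.Finite.mem_toFinset, Set.mem_ofPred_eq,
        mem_palindromicNecklaceReps]
      constructor
      · rintro ⟨hw, u, hu, huv⟩
        obtain ⟨b, hb, hmin⟩ := Set.exists_min_image {u | u ~r w} id
          ((List.finite_length_eq α w.length).subset fun u hu => hu.perm.length_eq)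
          ⟨w, List.IsRotated.refl w⟩
        have hw' := (hA w).1 hw
        refine ⟨b, ⟨⟨hb.perm.length_eq.trans hw'.1, ?_, fun u hu => hmin u (hu.trans hb)⟩,
          (hmin u hu).trans_lt huv⟩, hw, hb.symm⟩
        refine hb.reverse.trans (List.IsRotated.trans ?_ hb.symm)
        rw [hw'.2]
        exact List.IsRotated.forall w e
      · rintro ⟨b, ⟨_, hbv⟩, hw, hwb⟩
        exact ⟨hw, b, hwb.symm, hbv⟩
    · intro b hb c hc hbc
      simp only [Finset.mem_coe, Set.Finite.mem_toFinset, Set.mem_ofPred_eq,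
        mem_palindromicNecklaceReps] at hb hc
      rw [Function.onFun, Finset.disjoint_left]
      intro w hw hw'
      rw [Finset.mem_filter] at hw hw'
      have h : b ~r c := hw.2.symm.trans hw'.2
      exact hbc (le_antisymm (hb.1.2.2 c h.symm) (hc.1.2.2 b h))
  rw [aux _ 0 fun u => by rw [mem_palindromes, List.rotate_zero],
    aux _ 1 fun u => mem_tailPalindromes (List.length_pos_iff.2 hv), ← Finset.sum_add_distrib]
  rw [Finset.sum_congr rfl (g := fun _ => 2), Finset.sum_const, RP, wordRank,
    Set.ncard_eq_toFinset_card _ hfin, smul_eq_mul, mul_comm]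
  intro b hb
  simp only [Set.Finite.mem_toFinset, Set.mem_ofPred_eq, mem_palindromicNecklaceReps] at hb
  rw [← hb.1.1]
  refine card_fixed_rotations (fun h => hv ?_) hb.1.2.1
  rw [← List.length_eq_zero_iff, ← hb.1.1, h, List.length_nil]

end Rank

/-! ### The automaton of the words without a rotation below `v` -/

theorem take_succ_suffix_concat {α : Type*} {v u : List α} {a : α} {j : ℕ} (hj : j < v.length) :
    v.take (j + 1) <:+ u ++ [a] ↔ v[j] = a ∧ v.take j <:+ u := by
  rw [← List.take_concat_get' v j hj, List.suffix_concat_iff]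
  constructor
  · rintro (h | ⟨t, h, ht⟩)
    · exact absurd h (List.append_ne_nil_of_right_ne_nil _ (List.cons_ne_nil _ _))
    · obtain ⟨rfl, h'⟩ := List.append_inj' h rfl
      exact ⟨List.singleton_inj.1 h', ht⟩
  · rintro ⟨rfl, h⟩
    exact Or.inr ⟨_, rfl, h⟩

section Automaton

open scoped List

variable {α : Type*} [LinearOrder α]

/-- A minimal word that witnesses a descent below `v`: a proper prefix of `v` followed by a letter
smaller than the next letter of `v`. -/
def IsForbidden (v f : List α) : Prop :=
  ∃ (j : ℕ) (h : j < v.length) (x : α), x < v[j] ∧ f = v.take j ++ [x]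

/-- The word `u` contains no forbidden factor. -/
def Clean (v u : List α) : Prop :=
  ∀ f, IsForbidden v f → ¬ f <:+: u

/-- The length of the longest proper prefix of `v` that is a suffix of `u`. -/
def border (v u : List α) : ℕ :=
  Nat.findGreatest (fun j => v.take j <:+ u) (v.length - 1)

open scoped Classical in
/-- The state reached after reading `u`: the length of the longest proper prefix of `v` that ends
`u`, or the dead state `v.length` if `u` has a forbidden factor. -/
noncomputable def stateOf (v u : List α) : ℕ :=
  if Clean v u then border v u else v.length

/-- The transition function of the automaton; `v.length` is the dead state. -/
noncomputable def transition (v : List α) (s : ℕ) (a : α) : ℕ :=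
  if s < v.length then stateOf v (v.take s ++ [a]) else v.length

variable {v : List α}

theorem border_lt (hv : v ≠ []) (u : List α) : border v u < v.length := by
  have := Nat.findGreatest_le (P := fun j => v.take j <:+ u) (v.length - 1)
  have := List.length_pos_iff.2 hv
  unfold border
  omega

theorem take_border_suffix (v u : List α) : v.take (border v u) <:+ u :=
  Nat.findGreatest_spec (P := fun j => v.take j <:+ u) (Nat.zero_le _) (by simp)

theorem le_border {u : List α} {j : ℕ} (hj : j < v.length) (h : v.take j <:+ u) :
    j ≤ border v u :=
  Nat.le_findGreatest (by omega) h

theorem border_eq {u : List α} {m : ℕ} (hm : m < v.length) (h : v.take m <:+ u)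
    (hmax : ∀ j < v.length, v.take j <:+ u → j ≤ m) : border v u = m :=
  le_antisymm (hmax _ (border_lt (List.length_pos_iff.1 (by omega)) u) (take_border_suffix v u))
    (le_border hm h)

theorem border_congr (hv : v ≠ []) {u u' : List α}
    (h : ∀ j < v.length, v.take j <:+ u ↔ v.take j <:+ u') : border v u = border v u' :=
  border_eq (border_lt hv u') ((h _ (border_lt hv u')).2 (take_border_suffix v u'))
    fun j hj hs => le_border hj ((h j hj).1 hs)

theorem take_suffix_take_border {u : List α} {j : ℕ} (hj : j < v.length) :
    v.take j <:+ u ↔ v.take j <:+ v.take (border v u) := by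
  constructor
  · intro h
    refine List.suffix_of_suffix_length_le h (take_border_suffix v u) ?_
    have := le_border hj h
    simp only [List.length_take]
    omega
  · exact fun h => h.trans (take_border_suffix v u)

theorem border_concat_congr (hv : v ≠ []) {u u' : List α} (a : α)
    (h : ∀ j < v.length, v.take j <:+ u ↔ v.take j <:+ u') :
    border v (u ++ [a]) = border v (u' ++ [a]) := by
  refine border_congr hv fun j hj => ?_
  cases j with
  | zero => simp
  | succ j =>
    rw [take_succ_suffix_concat (by omega), take_succ_suffix_concat (by omega), h j (by omega)]

theorem Clean.mono {u u' : List α} (h : Clean v u') (hu : u <:+: u') : Clean v u :=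
  fun f hf hfu => h f hf (hfu.trans hu)

theorem clean_concat {u : List α} {a : α} :
    Clean v (u ++ [a]) ↔
      Clean v u ∧ ∀ (j : ℕ) (hj : j < v.length), v.take j <:+ u → ¬ a < v[j] := by
  constructor
  · intro h
    refine ⟨h.mono (List.prefix_append u [a]).isInfix, fun j hj hs ha => ?_⟩
    exact h _ ⟨j, hj, a, ha, rfl⟩ (List.suffix_append_self_iff.2 hs).isInfix
  · rintro ⟨h1, h2⟩ f hf hi
    rcases List.infix_concat_iff.1 hi with h | h
    · obtain ⟨j, hj, x, hx, rfl⟩ := hf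
      rcases List.suffix_concat_iff.1 h with h | ⟨t, h, ht⟩
      · simp at h
      · obtain ⟨rfl, h⟩ := List.append_inj' h rfl
        obtain rfl : x = a := by simpa using h
        exact h2 j hj ht hx
    · exact h1 f hf h

theorem stateOf_le (hv : v ≠ []) (u : List α) : stateOf v u ≤ v.length := by
  unfold stateOf
  split_ifs
  · exact (border_lt hv u).le
  · exact le_rfl

theorem stateOf_lt_iff (hv : v ≠ []) {u : List α} : stateOf v u < v.length ↔ Clean v u := by
  unfold stateOf
  split_ifs with h
  · exact ⟨fun _ => h, fun _ => border_lt hv u⟩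
  · simp [h]

theorem transition_le (hv : v ≠ []) (s : ℕ) (a : α) : transition v s a ≤ v.length := by
  unfold transition
  split_ifs
  · exact stateOf_le hv _
  · exact le_rfl

/-- The automaton computes `stateOf`. -/
theorem stateOf_concat (hv : v ≠ []) (u : List α) (a : α) :
    stateOf v (u ++ [a]) = transition v (stateOf v u) a := by
  by_cases hu : Clean v u
  · have hs : stateOf v u = border v u := if_pos hu
    have hc : Clean v (u ++ [a]) ↔ Clean v (v.take (border v u) ++ [a]) := by
      rw [clean_concat, clean_concat]
      refine and_congr (iff_of_true hu (hu.mono (take_border_suffix v u).isInfix)) ?_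
      exact forall₂_congr fun j hj => by rw [take_suffix_take_border hj]
    rw [hs, transition, if_pos (border_lt hv u)]
    by_cases h : Clean v (u ++ [a])
    · rw [stateOf, stateOf, if_pos h, if_pos (hc.1 h)]
      exact border_concat_congr hv a fun j hj => take_suffix_take_border hj
    · rw [stateOf, stateOf, if_neg h, if_neg fun h' => h (hc.2 h')]
  · have hs : stateOf v u = v.length := if_neg hu
    have : ¬ Clean v (u ++ [a]) := fun h => hu (clean_concat.1 h).1
    rw [hs, transition, if_neg (lt_irrefl _), stateOf, if_neg this]

theorem foldl_transition (hv : v ≠ []) (u w : List α) :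
    w.foldl (transition v) (stateOf v u) = stateOf v (u ++ w) := by
  induction w generalizing u with
  | nil => simp
  | cons a w ih => rw [List.foldl_cons, ← stateOf_concat hv, ih, List.append_assoc]; rfl

theorem foldl_transition_dead (v w : List α) :
    w.foldl (transition v) v.length = v.length := by
  induction w with
  | nil => rfl
  | cons a w ih => rw [List.foldl_cons, transition, if_neg (lt_irrefl _), ih]

theorem clean_take_concat {s : ℕ} (hs : s < v.length) (a : α) :
    Clean v (v.take s ++ [a]) ↔ ¬ a < v[s] ∧ Clean v (v.take s ++ [a]).tail := by
  constructor
  · intro h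
    refine ⟨fun ha => h _ ⟨s, hs, a, ha, rfl⟩ (List.infix_refl _),
      h.mono (List.tail_suffix _).isInfix⟩
  · rintro ⟨h1, h2⟩ f hf hi
    have hne : v.take s ++ [a] ≠ [] := by simp
    rw [← List.cons_head_tail hne, List.infix_cons_iff, List.cons_head_tail hne] at hi
    rcases hi with h | h
    · obtain ⟨j, hj, x, hx, rfl⟩ := hf
      rcases List.prefix_concat_iff.1 h with h | h
      · have hl := congrArg List.length h
        simp only [List.length_append, List.length_take, List.length_cons, List.length_nil] at hl
        obtain rfl : j = s := by omega
        obtain ⟨-, h⟩ := List.append_inj' h rfl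
        obtain rfl : x = a := by simpa using h
        exact h1 hx
      · have h := List.prefix_iff_eq_take.1 (h.trans (List.take_prefix s v))
        have hl : (v.take j ++ [x]).length = j + 1 := by
          simp only [List.length_append, List.length_take, List.length_cons, List.length_nil]
          omega
        rw [hl, ← List.take_concat_get' v j hj] at h
        obtain ⟨-, h⟩ := List.append_inj' h rfl
        obtain rfl : x = v[j] := by simpa using h
        exact lt_irrefl _ hx
    · exact h2 f hf h

/-- The recursion of Knuth, Morris and Pratt: the transitions from a state `s` are those of the
state reached by `(v.take s).tail`, except for the letters at most `v[s]`. -/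
theorem stateOf_take_concat {s : ℕ} (hs : s < v.length) (a : α) :
    stateOf v (v.take s ++ [a]) =
      if a < v[s] then v.length
      else if a = v[s] ∧ stateOf v (v.take s ++ [a]).tail < v.length ∧ s + 1 < v.length then s + 1
      else stateOf v (v.take s ++ [a]).tail := by
  have hv : v ≠ [] := List.length_pos_iff.1 (by omega)
  have hne : v.take s ++ [a] ≠ [] := by simp
  have hlen : (v.take s ++ [a]).length = s + 1 := by
    simp only [List.length_append, List.length_take, List.length_cons, List.length_nil]
    omega
  have hlt := stateOf_lt_iff hv (u := (v.take s ++ [a]).tail)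
  by_cases ha : a < v[s]
  · rw [if_pos ha, stateOf, if_neg fun h => ((clean_take_concat hs a).1 h).1 ha]
  rw [if_neg ha]
  by_cases hc : Clean v (v.take s ++ [a]).tail
  swap
  · rw [if_neg fun h => hc (hlt.1 h.2.1), stateOf, stateOf, if_neg hc,
      if_neg fun h => hc ((clean_take_concat hs a).1 h).2]
  have hs1 : stateOf v (v.take s ++ [a]) = border v (v.take s ++ [a]) :=
    if_pos ((clean_take_concat hs a).2 ⟨ha, hc⟩)
  rw [hs1]
  split_ifs with h
  · obtain ⟨rfl, -, hs'⟩ := h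
    refine border_eq hs' ?_ fun j hj h => ?_
    · rw [List.take_concat_get' v s hs]
    · have := h.length_le
      rw [hlen, List.length_take] at this
      omega
  · rw [stateOf, if_pos hc]
    refine border_congr hv fun j hj => ?_
    conv_lhs => rw [← List.cons_head_tail hne, List.suffix_cons_iff, List.cons_head_tail hne]
    refine or_iff_right fun hj' => h ?_
    have hl := congrArg List.length hj'
    rw [hlen, List.length_take, min_eq_left hj.le] at hl
    subst hl
    rw [← List.take_concat_get' v s hs] at hj'
    obtain ⟨-, h⟩ := List.append_inj' hj' rfl
    exact ⟨by simpa using h.symm, hlt.2 hc, hj⟩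

theorem clean_append_self_iff {w : List α} (hw : w.length = v.length) :
    Clean v (w ++ w) ↔ ∀ u, u ~r w → v ≤ u := by
  constructor
  · intro h u hu
    obtain ⟨p, hp, rfl⟩ := List.isRotated_iff_mod.1 hu.symm
    rw [← not_lt]
    intro hlt
    have hi : w.rotate p <:+: w ++ w := by
      rw [List.rotate_eq_drop_append_take hp]
      refine ⟨w.take p, w.drop p, ?_⟩
      rw [← List.append_assoc, List.take_append_drop, List.append_assoc, List.take_append_drop]
    rcases List.lt_iff_exists.1 hlt with ⟨-, h2⟩ | ⟨j, h1, h2, h3, h4⟩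
    · rw [List.length_rotate, hw] at h2
      exact lt_irrefl _ h2
    · refine h ((w.rotate p).take (j + 1)) ⟨j, h2, _, h4, ?_⟩
        ((List.take_prefix _ _).isInfix.trans hi)
      rw [← List.take_concat_get' _ j h1]
      congr 1
      refine List.ext_getElem (by simp only [List.length_take]; omega) fun i hi _ => ?_
      simp only [List.length_take] at hi
      simpa using h3 i (by omega)
  · rintro h f ⟨j, hj, x, hx, rfl⟩ ⟨p, q, hpq⟩
    have hlen := congrArg List.length hpq
    simp only [List.length_append, List.length_take, List.length_cons, List.length_nil] at hlen
    have hdrop : v.take j ++ [x] <+: (w ++ w).drop p.length := by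
      rw [← hpq, List.append_assoc, List.drop_left]
      exact List.prefix_append _ _
    have hrot : ∃ u, u ~r w ∧ v.take j ++ [x] <+: u := by
      rcases le_total p.length w.length with hp | hp
      · refine ⟨w.rotate p.length, List.IsRotated.forall w _, ?_⟩
        rw [List.rotate_eq_drop_append_take hp]
        rw [List.drop_append_of_le_length hp] at hdrop
        refine List.prefix_of_prefix_length_le hdrop
          ((List.prefix_append_right_inj _).2 (List.take_prefix _ _)) ?_
        simp only [List.length_append, List.length_take, List.length_cons, List.length_nil,
          List.length_drop]
        omega
      · refine ⟨w.rotate (p.length - w.length), List.IsRotated.forall w _, ?_⟩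
        rw [List.rotate_eq_drop_append_take (by omega)]
        rw [List.drop_append, List.drop_of_length_le hp, List.nil_append] at hdrop
        exact hdrop.trans (List.prefix_append _ _)
    obtain ⟨u, hu, t, rfl⟩ := hrot
    refine absurd (h _ hu) (not_le.2 ?_)
    conv_rhs => rw [← List.take_append_drop j v, ← List.cons_getElem_drop_succ (h := hj)]
    rw [List.append_assoc]
    exact List.append_left_lt (List.cons_lt_cons_iff.2 (Or.inl hx))

/-- A live state that a word of the length of `v` leads back to itself exists only if no rotation
of the word is smaller than `v`, and is then determined by the word. -/
theorem foldl_transition_eq_self_iff {w : List α} (hv : v ≠ []) (hw : w.length = v.length)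
    {s : ℕ} (hs : s < v.length) :
    w.foldl (transition v) s = s ↔ (∀ u, u ~r w → v ≤ u) ∧ s = border v w := by
  have hborder : ∀ u, border v (u ++ w) = border v w := fun u => by
    refine border_congr hv fun j hj =>
      ⟨fun h => List.suffix_of_suffix_length_le h (List.suffix_append _ _) ?_,
        fun h => h.trans (List.suffix_append _ _)⟩
    simp only [List.length_take]
    omega
  rw [← clean_append_self_iff hw]
  constructor
  · intro h
    by_cases hc : Clean v (v.take s)
    · have h0 : stateOf v (v.take s) = s := by
        rw [stateOf, if_pos hc]
        refine border_eq hs (List.suffix_refl _) fun j hj h => ?_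
        have := h.length_le
        simp only [List.length_take] at this
        omega
      have h1 : stateOf v (v.take s ++ w) = s := by rw [← foldl_transition hv, h0, h]
      have h2 : stateOf v (v.take s ++ w ++ w) = s := by rw [← foldl_transition hv, h1, h]
      have hc2 : Clean v (v.take s ++ w ++ w) := by rwa [← stateOf_lt_iff hv, h2]
      rw [List.append_assoc] at hc2
      refine ⟨hc2.mono (List.suffix_append _ _).isInfix, ?_⟩
      rw [List.append_assoc] at h2
      rw [stateOf, if_pos hc2, ← List.append_assoc, hborder] at h2
      exact h2.symm
    · obtain ⟨a, w, rfl⟩ := List.exists_cons_of_length_pos (hw ▸ List.length_pos_iff.2 hv)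
      rw [List.foldl_cons, transition, if_pos hs, stateOf,
        if_neg fun h => hc (clean_concat.1 h).1, foldl_transition_dead] at h
      omega
  · rintro ⟨hc, rfl⟩
    have h1 : stateOf v w = border v w := if_pos (hc.mono (List.suffix_append _ _).isInfix)
    conv_lhs => rw [← h1, foldl_transition hv, stateOf, if_pos hc, hborder]

open scoped Classical in
/-- A word of the length of `v` labels one closed walk through live states if none of its rotations
is smaller than `v`, and no such walk otherwise. -/
theorem sum_closed_walks (hv : v ≠ []) {w : List α} (hw : w.length = v.length) :
    ∑ s ∈ Finset.range v.length, (if w.foldl (transition v) s = s then 1 else 0) =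
      if ∀ u, u ~r w → v ≤ u then 1 else 0 := by
  split_ifs with h
  · rw [Finset.sum_eq_single_of_mem (border v w) (Finset.mem_range.2 (border_lt hv w)), if_pos]
    · exact (foldl_transition_eq_self_iff hv hw (border_lt hv w)).2 ⟨h, rfl⟩
    · intro s hs hne
      rw [if_neg]
      exact fun h' => hne ((foldl_transition_eq_self_iff hv hw (Finset.mem_range.1 hs)).1 h').2
  · refine Finset.sum_eq_zero fun s hs => if_neg fun h' => h ?_
    exact ((foldl_transition_eq_self_iff hv hw (Finset.mem_range.1 hs)).1 h').1

end Automaton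

/-! ### Counting walks along palindromes -/

/-- The number of palindromes of length `l` over `{0, …, k - 1}` that lead from the state `t` to the
state `s`, for an automaton with `m` states and transition function `d`. A longer palindrome
`a q a` is split into its outer letters and `q`: the letter `a` leads from `t` to `d t a`, and `q`
leads on to a state `s'` with `d s' a = s`. -/
def walkCount (d : ℕ → ℕ → ℕ) (k m : ℕ) : ℕ → ℕ → ℕ → ℕ
  | 0, s, t => if t = s then 1 else 0
  | 1, s, t => ∑ a ∈ Finset.range k, if d t a = s then 1 else 0
  | l + 2, s, t => ∑ s' ∈ Finset.range m, ∑ a ∈ Finset.range k,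
      if d s' a = s then walkCount d k m l s' (d t a) else 0

/-- The number of closed walks at the state `s` labelled by palindromes of length `n` or by a letter
and a palindrome of length `n - 1`. -/
def closedWalkCount (d : ℕ → ℕ → ℕ) (k m n s : ℕ) : ℕ :=
  walkCount d k m n s s + ∑ a ∈ Finset.range k, walkCount d k m (n - 1) s (d s a)

section Walks

variable {k m : ℕ} {d : ℕ → ℕ → ℕ}

theorem foldl_lt (hd : ∀ s < m, ∀ a < k, d s a < m) (p : List (Fin k)) {t : ℕ} (ht : t < m) :
    p.foldl (fun s (a : Fin k) => d s a) t < m := by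
  induction p generalizing t with
  | nil => exact ht
  | cons a p ih => exact ih (hd t ht a a.2)

theorem walkCount_eq_sum (hd : ∀ s < m, ∀ a < k, d s a < m) (l s : ℕ) {t : ℕ} (ht : t < m) :
    walkCount d k m l s t =
      ∑ p ∈ palindromes (Fin k) l, if p.foldl (fun s (a : Fin k) => d s a) t = s then 1 else 0 := by
  induction l using Nat.twoStepInduction generalizing s t with
  | zero => rw [walkCount, palindromes, Finset.sum_singleton]; rfl
  | one =>
    rw [walkCount, palindromes, Finset.sum_image
      (List.singleton_injective.injOn), ← Fin.sum_univ_eq_sum_range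
      (fun a => if d t a = s then 1 else 0)]
    rfl
  | more l ih _ =>
    rw [walkCount, palindromes, Finset.sum_image, Finset.sum_product, Finset.sum_comm,
      ← Fin.sum_univ_eq_sum_range (fun a => ∑ s' ∈ Finset.range m,
        if d s' a = s then walkCount d k m l s' (d t a) else 0)]
    · refine Finset.sum_congr rfl fun a _ => ?_
      have hta := hd t ht a a.2
      calc _ = ∑ s' ∈ Finset.range m, ∑ p ∈ palindromes (Fin k) l,
            if p.foldl (fun s (a : Fin k) => d s a) (d t a) = s' then (if d s' a = s then 1 else 0)
              else 0 := by
            refine Finset.sum_congr rfl fun s' _ => ?_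
            rw [ih s' hta]
            split_ifs with h
            · rfl
            · simp
        _ = _ := by
            rw [Finset.sum_comm]
            refine Finset.sum_congr rfl fun p _ => ?_
            rw [Finset.sum_ite_eq, if_pos (Finset.mem_range.2 (foldl_lt hd p hta))]
            simp
    · rintro ⟨a, p⟩ _ ⟨b, q⟩ _ h
      simp only [List.cons.injEq] at h
      obtain ⟨rfl, h⟩ := h
      simpa using h

theorem walkCount_le (hd : ∀ s < m, ∀ a < k, d s a < m) (l s : ℕ) {t : ℕ} (ht : t < m) :
    walkCount d k m l s t ≤ k ^ l := by
  rw [walkCount_eq_sum hd l s ht, ← Finset.card_filter]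
  exact (Finset.card_filter_le _ _).trans
    ((card_palindromes_le l).trans_eq (by rw [Fintype.card_fin]))

theorem sum_walkCount_eq_sum_tailPalindromes (hd : ∀ s < m, ∀ a < k, d s a < m) (n : ℕ) {s : ℕ}
    (hs : s < m) :
    ∑ a ∈ Finset.range k, walkCount d k m (n - 1) s (d s a) =
      ∑ w ∈ tailPalindromes (Fin k) n,
        if w.foldl (fun s (a : Fin k) => d s a) s = s then 1 else 0 := by
  rw [tailPalindromes, Finset.sum_image, Finset.sum_product,
    ← Fin.sum_univ_eq_sum_range (fun a => walkCount d k m (n - 1) s (d s a))]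
  · refine Finset.sum_congr rfl fun a _ => ?_
    rw [walkCount_eq_sum hd _ _ (hd s hs a a.2)]
    rfl
  · rintro ⟨a, p⟩ _ ⟨b, q⟩ _ h
    simpa using h

end Walks

/-- The transition function of the automaton of `v` on natural numbers. -/
noncomputable def natTransition {k : ℕ} (v : List (Fin k)) (s a : ℕ) : ℕ :=
  if h : a < k then transition v s ⟨a, h⟩ else 0

section RankFormula

open scoped List

variable {k : ℕ} {v : List (Fin k)}

theorem natTransition_lt (hv : v ≠ []) (s : ℕ) {a : ℕ} (ha : a < k) :
    natTransition v s a < v.length + 1 := by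
  rw [natTransition, dif_pos ha]
  exact Nat.lt_succ_of_le (transition_le hv s _)

theorem natTransition_length (v : List (Fin k)) {a : ℕ} (ha : a < k) :
    natTransition v v.length a = v.length := by
  rw [natTransition, dif_pos ha, transition, if_neg (lt_irrefl _)]

/-- Summed over the live states, the closed walks count the words without a rotation below `v`;
at the dead state they count all words. -/
theorem two_mul_RP_add_sum_closedWalkCount (hv : v ≠ []) :
    2 * RP v + ∑ s ∈ Finset.range v.length,
        closedWalkCount (natTransition v) k (v.length + 1) v.length s =
      closedWalkCount (natTransition v) k (v.length + 1) v.length v.length := by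
  classical
  have hn := List.length_pos_iff.2 hv
  have hfun : (fun (s : ℕ) (a : Fin k) => natTransition v s a) = transition v := by
    funext s a
    rw [natTransition, dif_pos a.2]
  have hd : ∀ s < v.length + 1, ∀ a < k, natTransition v s a < v.length + 1 :=
    fun s _ a ha => natTransition_lt hv s ha
  have live : ∀ A : Finset (List (Fin k)), (∀ w ∈ A, w.length = v.length) →
      ((A.filter fun w => ∃ u, u ~r w ∧ u < v).card + ∑ s ∈ Finset.range v.length, ∑ w ∈ A,
        if w.foldl (transition v) s = s then 1 else 0) =
      ∑ w ∈ A, if w.foldl (transition v) v.length = v.length then 1 else 0 := by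
    intro A hA
    rw [Finset.sum_comm, Finset.card_filter, ← Finset.sum_add_distrib]
    refine Finset.sum_congr rfl fun w hw => ?_
    rw [sum_closed_walks hv (hA w hw), foldl_transition_dead, if_pos rfl]
    by_cases h : ∃ u, u ~r w ∧ u < v
    · rw [if_pos h, if_neg]
      push Not
      exact h
    · rw [if_neg h, if_pos]
      push Not at h
      exact h
  have h0 := live (palindromes (Fin k) v.length) fun w hw => (mem_palindromes.1 hw).1
  have h1 := live (tailPalindromes (Fin k) v.length) fun w hw => ((mem_tailPalindromes hn).1 hw).1
  have hW : ∀ s < v.length + 1,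
      closedWalkCount (natTransition v) k (v.length + 1) v.length s =
      (∑ w ∈ palindromes (Fin k) v.length, if w.foldl (transition v) s = s then 1 else 0) +
      ∑ w ∈ tailPalindromes (Fin k) v.length, if w.foldl (transition v) s = s then 1 else 0 := by
    intro s hs
    rw [closedWalkCount, walkCount_eq_sum hd _ _ hs, sum_walkCount_eq_sum_tailPalindromes hd _ hs,
      hfun]
  rw [hW _ (Nat.lt_succ_self _), two_mul_RP hv, ← h0, ← h1, Finset.sum_congr rfl fun s hs =>
    hW s ((Finset.mem_range.1 hs).trans (Nat.lt_succ_self _)), Finset.sum_add_distrib]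
  ring

end RankFormula

/-! ### A structured language for the random access machine -/

namespace RAM

/-- The variables of the structured programs. -/
inductive Var : Type
  | rN | rK | rOne | rZero | rN1 | rNm1 | rJ | rA | rS | rT | rL | rThr | rSrc | rVal | rX | rSt
  | rVj | rJn | rD | rE | rP | rQ | rLx | rLy | rAcc | rNeg | rTwo
  deriving DecidableEq

/-- The register that holds a variable. Registers `2` and `3` are reserved for the base of the
address computations and for intermediate results. -/
def Var.idx : Var → ℕ
  | rN => 4 | rK => 5 | rOne => 6 | rZero => 7 | rN1 => 8 | rNm1 => 9 | rJ => 10 | rA => 11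
  | rS => 12 | rT => 13 | rL => 14 | rThr => 15 | rSrc => 16 | rVal => 17 | rX => 18 | rSt => 19
  | rVj => 20 | rJn => 21 | rD => 22 | rE => 23 | rP => 24 | rQ => 25 | rLx => 26 | rLy => 27
  | rAcc => 28 | rNeg => 29 | rTwo => 30

theorem Var.idx_ge (v : Var) : 4 ≤ v.idx := by cases v <;> decide

theorem Var.idx_lt (v : Var) : v.idx < 32 := by cases v <;> decide

theorem Var.idx_injective : Function.Injective Var.idx := by
  intro v w h
  cases v <;> cases w <;> first | rfl | exact absurd h (by decide)

/-- The state of a structured program: the variables, a three-dimensional array, and a part of the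
input that can be read only. -/
structure State : Type where
  reg : Var → ℕ
  heap : ℕ → ℕ → ℕ → ℕ
  input : ℕ → ℕ

/-- Assignment to a variable. -/
def State.set (σ : State) (d : Var) (c : ℕ) : State :=
  { σ with reg := fun y => if y = d then c else σ.reg y }

/-- Assignment to an array cell. -/
def State.setHeap (σ : State) (x y z c : ℕ) : State :=
  { σ with heap := fun x' y' z' => if x' = x ∧ y' = y ∧ z' = z then c else σ.heap x' y' z' }

@[simp] theorem State.set_reg (σ : State) (d : Var) (c : ℕ) (y : Var) :
    (σ.set d c).reg y = if y = d then c else σ.reg y := rfl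
@[simp] theorem State.set_heap (σ : State) (d : Var) (c : ℕ) : (σ.set d c).heap = σ.heap := rfl
@[simp] theorem State.set_input (σ : State) (d : Var) (c : ℕ) : (σ.set d c).input = σ.input := rfl
@[simp] theorem State.setHeap_reg (σ : State) (x y z c : ℕ) : (σ.setHeap x y z c).reg = σ.reg := rfl
@[simp] theorem State.setHeap_heap (σ : State) (x y z c x' y' z' : ℕ) :
    (σ.setHeap x y z c).heap x' y' z' =
      if x' = x ∧ y' = y ∧ z' = z then c else σ.heap x' y' z' := rfl
@[simp] theorem State.setHeap_input (σ : State) (x y z c : ℕ) :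
    (σ.setHeap x y z c).input = σ.input := rfl

/-- Structured programs: assignments, access to the array (`get`, `put`) and to the input (`peek`),
and control structures. The loop `loop i b c` runs `c` with `i = 0, …, b - 1`. -/
inductive Cmd : Type
  | skip
  | const (d : Var) (c : ℕ)
  | copy (d a : Var)
  | add (d a b : Var)
  | sub (d a b : Var)
  | div (d a b : Var)
  | peek (d a : Var)
  | get (d x y z : Var)
  | put (x y z a : Var)
  | seq (c₁ c₂ : Cmd)
  | ifLt (a b : Var) (c₁ c₂ : Cmd)
  | loop (i b : Var) (c : Cmd)

infixr:60 " ;; " => Cmd.seq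

/-- One round of a loop with counter `i` whose body acts as `f`. -/
def State.round (i : Var) (f : State → State) (σ : State) : State :=
  (f σ).set i ((f σ).reg i + 1)

namespace Cmd

/-- The effect of a structured program. -/
def ev : Cmd → State → State
  | skip, σ => σ
  | const d c, σ => σ.set d c
  | copy d a, σ => σ.set d (σ.reg a)
  | add d a b, σ => σ.set d (σ.reg a + σ.reg b)
  | sub d a b, σ => σ.set d (σ.reg a - σ.reg b)
  | div d a b, σ => σ.set d (σ.reg a / σ.reg b)
  | peek d a, σ => σ.set d (σ.input (σ.reg a))
  | get d x y z, σ => σ.set d (σ.heap (σ.reg x) (σ.reg y) (σ.reg z))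
  | put x y z a, σ => σ.setHeap (σ.reg x) (σ.reg y) (σ.reg z) (σ.reg a)
  | seq c₁ c₂, σ => c₂.ev (c₁.ev σ)
  | ifLt a b c₁ c₂, σ => if σ.reg a < σ.reg b then c₁.ev σ else c₂.ev σ
  | loop i b c, σ => (State.round i c.ev)^[σ.reg b] (σ.set i 0)

/-- The number of machine steps that a structured program takes. -/
def cost : Cmd → State → ℕ
  | skip, _ => 0
  | get _ _ _ _, _ => 5
  | put _ _ _ _, _ => 5
  | seq c₁ c₂, σ => c₁.cost σ + c₂.cost (c₁.ev σ)
  | ifLt a b c₁ c₂, σ => if σ.reg a < σ.reg b then c₁.cost σ + 1 else c₂.cost σ + 2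
  | loop i b c, σ =>
    ∑ j ∈ Finset.range (σ.reg b), (c.cost ((State.round i c.ev)^[j] (σ.set i 0)) + 4) + 3
  | _, _ => 1

/-- A cell of the array that has an address, for the base `M`, and an address of at most `B`. -/
def ValidCell (M B x y z : ℕ) : Prop :=
  y < M ∧ z < M ∧ (x ≠ 0 ∨ y ≠ 0) ∧ (x * M + y) * M + z ≤ B

/-- No value above `B` is produced, and all accesses to the array and to the input are valid. -/
def Safe (M B : ℕ) : Cmd → State → Prop
  | const _ c, _ => c ≤ B
  | add _ a b, σ => σ.reg a + σ.reg b ≤ B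
  | peek _ a, σ => 32 ≤ σ.reg a ∧ σ.reg a < M
  | get _ x y z, σ => ValidCell M B (σ.reg x) (σ.reg y) (σ.reg z)
  | put x y z _, σ => ValidCell M B (σ.reg x) (σ.reg y) (σ.reg z)
  | seq c₁ c₂, σ => c₁.Safe M B σ ∧ c₂.Safe M B (c₁.ev σ)
  | ifLt a b c₁ c₂, σ => if σ.reg a < σ.reg b then c₁.Safe M B σ else c₂.Safe M B σ
  | loop i b c, σ => ∀ j < σ.reg b, c.Safe M B ((State.round i c.ev)^[j] (σ.set i 0))
  | _, _ => True

/-- The variables that a structured program assigns. -/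
def writes : Cmd → List Var
  | skip => []
  | const d _ => [d]
  | copy d _ => [d]
  | add d _ _ => [d]
  | sub d _ _ => [d]
  | div d _ _ => [d]
  | peek d _ => [d]
  | get d _ _ _ => [d]
  | put _ _ _ _ => []
  | seq c₁ c₂ => c₁.writes ++ c₂.writes
  | ifLt _ _ c₁ c₂ => c₁.writes ++ c₂.writes
  | loop i _ c => i :: c.writes

/-- The counter and the bound of a loop are not assigned in its body. -/
def WellFormed : Cmd → Bool
  | seq c₁ c₂ => c₁.WellFormed && c₂.WellFormed
  | ifLt _ _ c₁ c₂ => c₁.WellFormed && c₂.WellFormed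
  | loop i b c => decide (i ≠ b) && decide (i ∉ c.writes) && decide (b ∉ c.writes) && c.WellFormed
  | _ => true

/-- The number of instructions of the translation. -/
def len : Cmd → ℕ
  | skip => 0
  | get _ _ _ _ => 5
  | put _ _ _ _ => 5
  | seq c₁ c₂ => c₁.len + c₂.len
  | ifLt _ _ c₁ c₂ => c₂.len + c₁.len + 2
  | loop _ _ c => c.len + 6
  | _ => 1

/-- The instructions that put the address of an array cell into register `3`. -/
def address (x y z : Var) : List Instr :=
  [.mul 3 x.idx 2, .add 3 3 y.idx, .mul 3 3 2, .add 3 3 z.idx]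

/-- The translation of a structured program to machine instructions numbered from `o`. -/
def compile : Cmd → ℕ → List Instr
  | skip, _ => []
  | const d c, _ => [.const d.idx c]
  | copy d a, _ => [.copy d.idx a.idx]
  | add d a b, _ => [.add d.idx a.idx b.idx]
  | sub d a b, _ => [.sub d.idx a.idx b.idx]
  | div d a b, _ => [.div d.idx a.idx b.idx]
  | peek d a, _ => [.load d.idx a.idx]
  | get d x y z, _ => address x y z ++ [.load d.idx 3]
  | put x y z a, _ => address x y z ++ [.store 3 a.idx]
  | seq c₁ c₂, o => c₁.compile o ++ c₂.compile (o + c₁.len)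
  | ifLt a b c₁ c₂, o =>
    .jumpLt a.idx b.idx (o + 1 + c₂.len + 1) :: (c₂.compile (o + 1) ++
      .jump (o + (c₂.len + c₁.len + 2)) :: c₁.compile (o + 1 + c₂.len + 1))
  | loop i b c, o =>
    .const i.idx 0 :: .jumpLt i.idx b.idx (o + 1 + 1 + 1) :: .jump (o + (c.len + 6)) ::
      (c.compile (o + 1 + 1 + 1) ++ [.const 3 1, .add i.idx i.idx 3, .jump (o + 1)])

theorem length_compile (c : Cmd) (o : ℕ) : (c.compile o).length = c.len := by
  induction c generalizing o <;> simp [compile, len, address, *]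
  omega

theorem ev_reg_of_notMem {c : Cmd} {y : Var} (h : y ∉ c.writes) (σ : State) :
    (c.ev σ).reg y = σ.reg y := by
  induction c generalizing σ with
  | seq c₁ c₂ ih₁ ih₂ =>
    simp only [writes, List.mem_append, not_or] at h
    rw [ev, ih₂ h.2, ih₁ h.1]
  | ifLt a b c₁ c₂ ih₁ ih₂ =>
    simp only [writes, List.mem_append, not_or] at h
    rw [ev]
    split_ifs
    · exact ih₁ h.1 σ
    · exact ih₂ h.2 σ
  | loop i b c ih =>
    simp only [writes, List.mem_cons, not_or] at h
    rw [ev]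
    generalize σ.reg b = N
    induction N with
    | zero => simp [h.1]
    | succ N ihN =>
      rw [Function.iterate_succ_apply', State.round, State.set_reg, if_neg h.1, ih h.2, ihN]
  | _ => simp_all [ev, writes]

theorem ev_input (c : Cmd) (σ : State) : (c.ev σ).input = σ.input := by
  induction c generalizing σ with
  | seq c₁ c₂ ih₁ ih₂ => rw [ev, ih₂, ih₁]
  | ifLt a b c₁ c₂ ih₁ ih₂ =>
    rw [ev]
    split_ifs
    · exact ih₁ σ
    · exact ih₂ σ
  | loop i b c ih =>
    rw [ev]
    generalize σ.reg b = N
    induction N with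
    | zero => rfl
    | succ N ihN => rw [Function.iterate_succ_apply', State.round, State.set_input, ih, ihN]
  | _ => rfl

end Cmd

/-! ### Correctness of the translation -/

/-- The program `P` leads from `c` to `c'` in `t` steps, with all registers bounded by `B`. -/
def Reaches (P : Program) (B : ℕ) (c : Config) (t : ℕ) (c' : Config) : Prop :=
  (step P)^[t] c = c' ∧ ∀ s ≤ t, ∀ a, ((step P)^[s] c).mem a ≤ B

theorem Reaches.refl {P : Program} {B : ℕ} {c : Config} (h : ∀ a, c.mem a ≤ B) :
    Reaches P B c 0 c :=
  ⟨rfl, fun s hs a => by rw [Nat.le_zero.1 hs]; exact h a⟩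

theorem Reaches.trans {P : Program} {B t₁ t₂ : ℕ} {c₁ c₂ c₃ : Config} (h₁ : Reaches P B c₁ t₁ c₂)
    (h₂ : Reaches P B c₂ t₂ c₃) : Reaches P B c₁ (t₁ + t₂) c₃ := by
  refine ⟨by rw [add_comm, Function.iterate_add_apply, h₁.1, h₂.1], fun s hs a => ?_⟩
  rcases le_total s t₁ with h | h
  · exact h₁.2 s h a
  · obtain ⟨r, rfl⟩ := Nat.exists_eq_add_of_le h
    rw [add_comm, Function.iterate_add_apply, h₁.1]
    exact h₂.2 r (by omega) a

theorem Reaches.step {P : Program} {B : ℕ} {pc : ℕ} {m : ℕ → ℕ} {i : Instr} {c' : Config}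
    (hi : P[pc]? = some i) (hc : i.exec ⟨pc, m⟩ = c') (hm : ∀ a, m a ≤ B)
    (hm' : ∀ a, c'.mem a ≤ B) : Reaches P B ⟨pc, m⟩ 1 c' := by
  have h : RAM.step P ⟨pc, m⟩ = c' := by simp only [RAM.step, hi, hc]
  refine ⟨h, fun s hs a => ?_⟩
  interval_cases s
  · exact hm a
  · rw [Function.iterate_one, h]
    exact hm' a

theorem getElem?_of_cons_prefix {P rest : Program} {o : ℕ} {i : Instr}
    (h : i :: rest <+: P.drop o) : P[o]? = some i ∧ rest <+: P.drop (o + 1) := by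
  obtain ⟨u, hu⟩ := h
  constructor
  · rw [← Nat.add_zero o, ← List.getElem?_drop, ← hu]
    rfl
  · rw [← List.drop_drop, ← hu]
    exact List.prefix_append _ _

theorem prefix_of_append_prefix {P c₁ c₂ : Program} {o : ℕ} (h : c₁ ++ c₂ <+: P.drop o) :
    c₁ <+: P.drop o ∧ c₂ <+: P.drop (o + c₁.length) := by
  refine ⟨(List.prefix_append _ _).trans h, ?_⟩
  obtain ⟨u, hu⟩ := h
  rw [← List.drop_drop, ← hu, List.append_assoc, List.drop_left]
  exact List.prefix_append _ _

/-- The memory `m` represents the state `σ`: the cell `(x, y, z)` of the array has the address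
`(x * M + y) * M + z`, and the registers from `32` to `M - 1` hold the input. -/
structure Represents (M B : ℕ) (m : ℕ → ℕ) (σ : State) : Prop where
  base_ge : 32 ≤ M
  reg : ∀ y : Var, m y.idx = σ.reg y
  base : m 2 = M
  input : ∀ i, 32 ≤ i → i < M → m i = σ.input i
  heap : ∀ x y z, y < M → z < M → x ≠ 0 ∨ y ≠ 0 → m ((x * M + y) * M + z) = σ.heap x y z
  bound : ∀ a, m a ≤ B

section Represents

variable {M B : ℕ} {m : ℕ → ℕ} {σ : State}

theorem base_le_address {x y : ℕ} (z : ℕ) (h : x ≠ 0 ∨ y ≠ 0) (hM : 32 ≤ M) :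
    M ≤ (x * M + y) * M + z := by
  have h1 : 1 ≤ x * M + y := by
    rcases h with h | h
    · have : 0 < x * M := Nat.mul_pos (Nat.pos_of_ne_zero h) (by omega)
      omega
    · omega
  calc M = 1 * M := (one_mul M).symm
    _ ≤ (x * M + y) * M := Nat.mul_le_mul_right M h1
    _ ≤ _ := Nat.le_add_right _ _

theorem address_injective {x y z x' y' z' : ℕ} (hy : y < M) (hz : z < M) (hy' : y' < M)
    (hz' : z' < M) (h : (x * M + y) * M + z = (x' * M + y') * M + z') :
    x = x' ∧ y = y' ∧ z = z' := by
  have key : ∀ {a b a' b' : ℕ}, b < M → b' < M → a * M + b = a' * M + b' → a = a' ∧ b = b' := by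
    intro a b a' b' hb hb' h
    have hM : 0 < M := by omega
    have h1 := congrArg (· / M) h
    have h2 := congrArg (· % M) h
    simp only [Nat.mul_add_mod', Nat.mod_eq_of_lt hb, Nat.mod_eq_of_lt hb'] at h2
    rw [h2] at h
    exact ⟨Nat.eq_of_mul_eq_mul_right hM (by omega), h2⟩
  obtain ⟨h1, h2⟩ := key hz hz' h
  obtain ⟨h3, h4⟩ := key hy hy' h1
  exact ⟨h3, h4, h2⟩

theorem Represents.set (h : Represents M B m σ) (d : Var) {c : ℕ} (hc : c ≤ B) :
    Represents M B (Function.update m d.idx c) (σ.set d c) := by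
  have hd := d.idx_ge
  have hd' := d.idx_lt
  have hM := h.base_ge
  refine ⟨hM, fun y => ?_, ?_, fun i hi hiM => ?_, fun x y z hy hz hxy => ?_, fun a => ?_⟩
  · rw [State.set_reg, Function.update_apply, h.reg]
    simp only [Var.idx_injective.eq_iff]
  · rw [Function.update_of_ne (by omega), h.base]
  · rw [Function.update_of_ne (by omega), h.input i hi hiM, State.set_input]
  · have := base_le_address z hxy hM
    rw [Function.update_of_ne (by omega), h.heap x y z hy hz hxy, State.set_heap]
  · rw [Function.update_apply]
    split_ifs
    · exact hc
    · exact h.bound a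

/-- Register `3` is not part of the state. -/
theorem Represents.update_three (h : Represents M B m σ) {c : ℕ} (hc : c ≤ B) :
    Represents M B (Function.update m 3 c) σ := by
  have hM := h.base_ge
  refine ⟨hM, fun y => ?_, ?_, fun i hi hiM => ?_, fun x y z hy hz hxy => ?_, fun a => ?_⟩
  · have := y.idx_ge
    rw [Function.update_of_ne (by omega), h.reg]
  · rw [Function.update_of_ne (by omega), h.base]
  · rw [Function.update_of_ne (by omega), h.input i hi hiM]
  · have := base_le_address z hxy hM
    rw [Function.update_of_ne (by omega), h.heap x y z hy hz hxy]
  · rw [Function.update_apply]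
    split_ifs
    · exact hc
    · exact h.bound a

theorem Represents.setHeap (h : Represents M B m σ) {x y z c : ℕ} (hy : y < M) (hz : z < M)
    (hxy : x ≠ 0 ∨ y ≠ 0) (hc : c ≤ B) :
    Represents M B (Function.update m ((x * M + y) * M + z) c) (σ.setHeap x y z c) := by
  have hM := h.base_ge
  have ha := base_le_address z hxy hM
  refine ⟨hM, fun y => ?_, ?_, fun i hi hiM => ?_, fun x' y' z' hy' hz' hxy' => ?_, fun a => ?_⟩
  · have := y.idx_lt
    rw [Function.update_of_ne (by omega), h.reg, State.setHeap_reg]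
  · rw [Function.update_of_ne (by omega), h.base]
  · rw [Function.update_of_ne (by omega), h.input i hi hiM, State.setHeap_input]
  · rw [State.setHeap_heap, Function.update_apply, h.heap x' y' z' hy' hz' hxy']
    refine if_congr ⟨fun h => address_injective hy' hz' hy hz h, ?_⟩ rfl rfl
    rintro ⟨rfl, rfl, rfl⟩
    rfl
  · rw [Function.update_apply]
    split_ifs
    · exact hc
    · exact h.bound a

theorem Represents.step_set (h : Represents M B m σ) {P : Program} {o : ℕ} {i : Instr} {d : Var}
    {c : ℕ} (hi : [i] <+: P.drop o) (he : i.exec ⟨o, m⟩ = ⟨o + 1, Function.update m d.idx c⟩)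
    (hc : c ≤ B) :
    ∃ m', Reaches P B ⟨o, m⟩ 1 ⟨o + 1, m'⟩ ∧ Represents M B m' (σ.set d c) :=
  ⟨_, Reaches.step (getElem?_of_cons_prefix hi).1 he h.bound (h.set d hc).bound, h.set d hc⟩

theorem Represents.address (h : Represents M B m σ) {P : Program} {o : ℕ} {x y z : Var}
    (hi : Cmd.address x y z <+: P.drop o)
    (hv : Cmd.ValidCell M B (σ.reg x) (σ.reg y) (σ.reg z)) :
    ∃ m', Reaches P B ⟨o, m⟩ 4 ⟨o + 4, m'⟩ ∧ Represents M B m' σ ∧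
      m' 3 = (σ.reg x * M + σ.reg y) * M + σ.reg z := by
  obtain ⟨-, -, -, hB⟩ := hv
  have hM := h.base_ge
  have hy := y.idx_ge
  have hz := z.idx_ge
  obtain ⟨i1, hi⟩ := getElem?_of_cons_prefix hi
  obtain ⟨i2, hi⟩ := getElem?_of_cons_prefix hi
  obtain ⟨i3, hi⟩ := getElem?_of_cons_prefix hi
  obtain ⟨i4, hi⟩ := getElem?_of_cons_prefix hi
  have hB3 : (σ.reg x * M + σ.reg y) * M ≤ B := by omega
  have hB2 : σ.reg x * M + σ.reg y ≤ B := (Nat.le_mul_of_pos_right _ (by omega)).trans hB3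
  have h1 := h.update_three (c := σ.reg x * M) (by omega)
  have h2 := h1.update_three hB2
  have h3 := h2.update_three hB3
  have h4 := h3.update_three hB
  refine ⟨_, (((Reaches.step i1 ?_ h.bound h1.bound).trans (Reaches.step i2 ?_ h1.bound
    h2.bound)).trans (Reaches.step i3 ?_ h2.bound h3.bound)).trans
    (Reaches.step i4 ?_ h3.bound h4.bound), h4, by rw [Function.update_self]⟩
  · simp only [Instr.exec, h.reg, h.base]
  · simp only [Instr.exec, h1.reg, Function.update_self]
  · simp only [Instr.exec, h2.base, Function.update_self]
  · simp only [Instr.exec, h3.reg, Function.update_self]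

end Represents

/-- The counter of a loop during the loop. -/
theorem iterate_round_reg {i : Var} {c : Cmd} (hi : i ∉ c.writes) (σ : State) (j : ℕ) :
    ((State.round i c.ev)^[j] (σ.set i 0)).reg i = j := by
  induction j with
  | zero => simp
  | succ j ih =>
    rw [Function.iterate_succ_apply', State.round, State.set_reg, if_pos rfl,
      Cmd.ev_reg_of_notMem hi, ih]

theorem iterate_round_reg_of_notMem {i y : Var} {c : Cmd} (hy : y ∉ (Cmd.loop i y c).writes)
    (σ : State) (j : ℕ) :
    ((State.round i c.ev)^[j] (σ.set i 0)).reg y = σ.reg y := by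
  simp only [Cmd.writes, List.mem_cons, not_or] at hy
  induction j with
  | zero => simp [hy.1]
  | succ j ih =>
    rw [Function.iterate_succ_apply', State.round, State.set_reg, if_neg hy.1,
      Cmd.ev_reg_of_notMem hy.2, ih]

/-- The translation of a structured program simulates it, in as many steps as its cost, and without
exceeding the bound `B`. -/
theorem Cmd.simulation {P : Program} {M B : ℕ} (hB : 1 ≤ B) (c : Cmd) (hwf : c.WellFormed = true)
    {o : ℕ} (hP : c.compile o <+: P.drop o) {m : ℕ → ℕ} {σ : State} (hm : Represents M B m σ)
    (hs : c.Safe M B σ) :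
    ∃ m', Reaches P B ⟨o, m⟩ (c.cost σ) ⟨o + c.len, m'⟩ ∧ Represents M B m' (c.ev σ) := by
  induction c generalizing o m σ with
  | skip => exact ⟨m, Reaches.refl hm.bound, hm⟩
  | const d c => exact hm.step_set hP rfl hs
  | copy d a => exact hm.step_set hP (by simp only [Instr.exec, hm.reg]) (hm.reg a ▸ hm.bound _)
  | add d a b => exact hm.step_set hP (by simp only [Instr.exec, hm.reg]) hs
  | sub d a b =>
    exact hm.step_set hP (by simp only [Instr.exec, hm.reg])
      ((Nat.sub_le _ _).trans (hm.reg a ▸ hm.bound _))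
  | div d a b =>
    exact hm.step_set hP (by simp only [Instr.exec, hm.reg])
      ((Nat.div_le_self _ _).trans (hm.reg a ▸ hm.bound _))
  | peek d a =>
    have h := hm.input _ hs.1 hs.2
    exact hm.step_set hP (by simp only [Instr.exec, hm.reg, h]) (h ▸ hm.bound _)
  | get d x y z =>
    obtain ⟨hP1, hP2⟩ := prefix_of_append_prefix hP
    obtain ⟨m1, hr, hm1, h3⟩ := hm.address hP1 hs
    have h := hm1.heap _ _ _ hs.1 hs.2.1 hs.2.2.1
    obtain ⟨m2, hr2, hm2⟩ := hm1.step_set (i := .load d.idx 3) (d := d) (o := o + 4) hP2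
      (by simp only [Instr.exec, h3, h]) (h ▸ hm1.bound _)
    exact ⟨m2, hr.trans hr2, hm2⟩
  | put x y z a =>
    obtain ⟨hP1, hP2⟩ := prefix_of_append_prefix hP
    obtain ⟨m1, hr, hm1, h3⟩ := hm.address hP1 hs
    have hm2 := hm1.setHeap hs.1 hs.2.1 hs.2.2.1 (hm1.reg a ▸ hm1.bound _)
    exact ⟨_, hr.trans (Reaches.step (getElem?_of_cons_prefix hP2).1
      (by simp only [Instr.exec, h3, hm1.reg]; rfl) hm1.bound hm2.bound), hm2⟩
  | seq c₁ c₂ ih₁ ih₂ =>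
    simp only [WellFormed, Bool.and_eq_true] at hwf
    obtain ⟨hP1, hP2⟩ := prefix_of_append_prefix hP
    rw [length_compile] at hP2
    obtain ⟨m1, hr1, hm1⟩ := ih₁ hwf.1 hP1 hm hs.1
    obtain ⟨m2, hr2, hm2⟩ := ih₂ hwf.2 hP2 hm1 hs.2
    refine ⟨m2, ?_, hm2⟩
    rw [len, ← add_assoc]
    exact hr1.trans hr2
  | ifLt a b c₁ c₂ ih₁ ih₂ =>
    simp only [WellFormed, Bool.and_eq_true] at hwf
    obtain ⟨i1, hP⟩ := getElem?_of_cons_prefix hP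
    obtain ⟨hP2, hP1⟩ := prefix_of_append_prefix hP
    obtain ⟨i2, hP1⟩ := getElem?_of_cons_prefix hP1
    rw [length_compile] at hP1 i2
    rw [Safe] at hs
    rw [cost, ev]
    by_cases hab : σ.reg a < σ.reg b
    · rw [if_pos hab] at hs ⊢
      rw [if_pos hab]
      obtain ⟨m1, hr1, hm1⟩ := ih₁ hwf.1 hP1 hm hs
      refine ⟨m1, ?_, hm1⟩
      rw [add_comm]
      have := (Reaches.step i1 (by simp only [Instr.exec, hm.reg, if_pos hab]) hm.bound
        hm.bound).trans hr1
      rwa [show o + 1 + c₂.len + 1 + c₁.len = o + (ifLt a b c₁ c₂).len by rw [len]; ring] at this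
    · rw [if_neg hab] at hs ⊢
      rw [if_neg hab]
      obtain ⟨m1, hr1, hm1⟩ := ih₂ hwf.2 hP2 hm hs
      refine ⟨m1, ?_, hm1⟩
      have := ((Reaches.step i1 (by simp only [Instr.exec, hm.reg, if_neg hab]) hm.bound
        hm.bound).trans hr1).trans (Reaches.step i2 rfl hm1.bound hm1.bound)
      rwa [show 1 + c₂.cost σ + 1 = c₂.cost σ + 2 by ring] at this
  | loop i b c ih =>
    simp only [WellFormed, Bool.and_eq_true, decide_eq_true_eq] at hwf
    obtain ⟨⟨⟨hib, hi⟩, hb⟩, hwf⟩ := hwf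
    obtain ⟨i1, hP⟩ := getElem?_of_cons_prefix hP
    obtain ⟨i2, hP⟩ := getElem?_of_cons_prefix hP
    obtain ⟨i3, hP⟩ := getElem?_of_cons_prefix hP
    obtain ⟨hPc, hP⟩ := prefix_of_append_prefix hP
    rw [length_compile] at hP
    obtain ⟨i4, hP⟩ := getElem?_of_cons_prefix hP
    obtain ⟨i5, hP⟩ := getElem?_of_cons_prefix hP
    obtain ⟨i6, -⟩ := getElem?_of_cons_prefix hP
    have hi0 := iterate_round_reg hi σ
    have hb0 : ∀ j, ((State.round i c.ev)^[j] (σ.set i 0)).reg b = σ.reg b :=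
      iterate_round_reg_of_notMem (by simp [writes, hb, Ne.symm hib]) σ
    have hNB : σ.reg b ≤ B := hm.reg b ▸ hm.bound _
    -- The configuration at the loop test after `j` rounds.
    have key : ∀ j ≤ σ.reg b, ∃ m', Reaches P B ⟨o, m⟩
        (∑ j ∈ Finset.range j, (c.cost ((State.round i c.ev)^[j] (σ.set i 0)) + 4) + 1)
        ⟨o + 1, m'⟩ ∧ Represents M B m' ((State.round i c.ev)^[j] (σ.set i 0)) := by
      intro j hj
      induction j with
      | zero =>
        have h0 := hm.set i (c := 0) (by omega)
        exact ⟨_, Reaches.step i1 rfl hm.bound h0.bound, h0⟩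
      | succ j ihj =>
        obtain ⟨m1, hr1, hm1⟩ := ihj (by omega)
        obtain ⟨m2, hr2, hm2⟩ := ih hwf hPc hm1 (hs j (by omega))
        have hm3 := hm2.update_three hB
        have hreg : ((c.ev ((State.round i c.ev)^[j] (σ.set i 0)))).reg i = j := by
          rw [ev_reg_of_notMem hi, hi0]
        have hm4 := hm3.set i (c := j + 1) (by omega)
        rw [Function.iterate_succ_apply', State.round, hreg, Finset.sum_range_succ]
        have h2 := Reaches.step (P := P) (B := B) (pc := o + 1) (m := m1) i2
          (by simp only [Instr.exec, hm1.reg, hi0, hb0]; rw [if_pos (by omega)]) hm1.bound hm1.bound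
        have h4 := Reaches.step (P := P) (B := B) i4 rfl hm2.bound hm3.bound
        have h5 := Reaches.step (P := P) (B := B)
          (c' := ⟨o + 1 + 1 + 1 + c.len + 1 + 1,
            Function.update (Function.update m2 3 1) i.idx (j + 1)⟩) i5
          (by simp only [Instr.exec, hm3.reg, hreg, Function.update_self]) hm3.bound hm4.bound
        have h6 := Reaches.step (P := P) (B := B) i6 rfl hm4.bound hm4.bound
        have h := ((((hr1.trans h2).trans hr2).trans h4).trans h5).trans h6
        refine ⟨_, ?_, hm4⟩
        convert h using 1
        · ring
        · rfl
    obtain ⟨m1, hr1, hm1⟩ := key _ le_rfl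
    have h2 := Reaches.step (P := P) (B := B) (pc := o + 1) (m := m1) i2
      (by simp only [Instr.exec, hm1.reg, hi0, hb0]; rw [if_neg (lt_irrefl _)]) hm1.bound hm1.bound
    have h3 := Reaches.step (P := P) (B := B) i3 rfl hm1.bound hm1.bound
    exact ⟨m1, (hr1.trans h2).trans h3, hm1⟩

open Var

/-! ### Reasoning about structured programs -/

/-- From the state `σ`, the program `c` is safe, takes at most `T` steps, and leads to a state that
satisfies `Q`. -/
def Meets (M B : ℕ) (c : Cmd) (σ : State) (T : ℕ) (Q : State → Prop) : Prop :=
  c.Safe M B σ ∧ c.cost σ ≤ T ∧ Q (c.ev σ)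

/-- The states `σ` and `τ` agree on all variables that `c` does not assign. -/
def AgreeOff (c : Cmd) (σ τ : State) : Prop :=
  ∀ y ∉ c.writes, τ.reg y = σ.reg y

section Rules

variable {M B : ℕ} {σ : State} {Q : State → Prop}

theorem Meets.mono {c : Cmd} {T T' : ℕ} {Q' : State → Prop} (h : Meets M B c σ T Q) (hT : T ≤ T')
    (hQ : ∀ τ, Q τ → Q' τ) : Meets M B c σ T' Q' :=
  ⟨h.1, h.2.1.trans hT, hQ _ h.2.2⟩

theorem Meets.seq {c₁ c₂ : Cmd} {T₁ T₂ : ℕ} {Q₁ : State → Prop} (h₁ : Meets M B c₁ σ T₁ Q₁)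
    (h₂ : ∀ τ, AgreeOff c₁ σ τ → τ.input = σ.input → Q₁ τ → Meets M B c₂ τ T₂ Q) :
    Meets M B (c₁ ;; c₂) σ (T₁ + T₂) Q := by
  obtain ⟨h1, h2, h3⟩ := h₂ _ (fun y hy => Cmd.ev_reg_of_notMem hy σ) (Cmd.ev_input c₁ σ) h₁.2.2
  exact ⟨⟨h₁.1, h1⟩, add_le_add h₁.2.1 h2, h3⟩

/-- The rule for a first part whose effect is written out. -/
theorem Meets.seq_ev {c₁ c₂ : Cmd} {T₁ T₂ : ℕ} (hs : c₁.Safe M B σ) (hc : c₁.cost σ ≤ T₁)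
    (h₂ : Meets M B c₂ (c₁.ev σ) T₂ Q) : Meets M B (c₁ ;; c₂) σ (T₁ + T₂) Q :=
  ⟨⟨hs, h₂.1⟩, add_le_add hc h₂.2.1, h₂.2.2⟩

/-- The rule for loops, with an invariant `I` and a bound `T` for the rounds. -/
theorem Meets.loop {i b : Var} {c : Cmd} {N T : ℕ} (I : ℕ → State → Prop)
    (hwf : (Cmd.loop i b c).WellFormed = true) (hN : σ.reg b = N) (h0 : I 0 (σ.set i 0))
    (hstep : ∀ j < N, ∀ τ, AgreeOff (Cmd.loop i b c) σ τ → τ.reg i = j → τ.input = σ.input →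
      I j τ → Meets M B c τ T fun τ' => I (j + 1) (τ'.set i (j + 1))) :
    Meets M B (Cmd.loop i b c) σ (N * (T + 4) + 3) (I N) := by
  simp only [Cmd.WellFormed, Bool.and_eq_true, decide_eq_true_eq] at hwf
  obtain ⟨⟨⟨-, hi⟩, -⟩, -⟩ := hwf
  have hreg := iterate_round_reg hi σ
  have hinput : ∀ j, ((State.round i c.ev)^[j] (σ.set i 0)).input = σ.input := by
    intro j
    induction j with
    | zero => rfl
    | succ j ih => rw [Function.iterate_succ_apply', State.round, State.set_input, Cmd.ev_input, ih]
  have key : ∀ j ≤ N, I j ((State.round i c.ev)^[j] (σ.set i 0)) := by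
    intro j hj
    induction j with
    | zero => exact h0
    | succ j ih =>
      rw [Function.iterate_succ_apply', State.round, Cmd.ev_reg_of_notMem hi, hreg]
      exact (hstep j (by omega) _ (fun y hy => iterate_round_reg_of_notMem hy σ j) (hreg j)
        (hinput j) (ih (by omega))).2.2
  have key' : ∀ j < N, Meets M B c ((State.round i c.ev)^[j] (σ.set i 0)) T
      fun τ' => I (j + 1) (τ'.set i (j + 1)) := fun j hj =>
    hstep j hj _ (fun y hy => iterate_round_reg_of_notMem hy σ j) (hreg j) (hinput j)
      (key j hj.le)
  refine ⟨fun j hj => (key' j (hN ▸ hj)).1, ?_, ?_⟩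
  · rw [Cmd.cost, hN]
    refine Nat.add_le_add_right ((Finset.sum_le_card_nsmul _ _ (T + 4) fun j hj => ?_).trans ?_) 3
    · exact Nat.add_le_add_right (key' j (Finset.mem_range.1 hj)).2.1 4
    · rw [Finset.card_range, smul_eq_mul]
  · rw [Cmd.ev, hN]
    exact key N le_rfl

end Rules

open Cmd

/-! ### The program -/

/-- The first index of the array at the row of the letter `rA` of the transition table. -/
def tableIndex : Cmd := add rX rA rN1 ;; add rX rX rOne

/-- Sets the variables that stay constant from then on. -/
def setup : Cmd :=
  const rOne 1 ;; const rZero 0 ;; const rTwo 2 ;; const rThr 30 ;; add rN1 rN rOne ;;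
    sub rNm1 rN rOne

/-- Copies the letters of the input word to the array. The first `30` letters, whose registers are
used for variables, are already there; the letter `i` for `i ≥ 30` is still in register `i + 2`. -/
def copyIn : Cmd :=
  loop rJ rN (ifLt rJ rThr skip (add rSrc rJ rTwo ;; peek rVal rSrc ;; put rZero rOne rJ rVal))

/-- The transitions from the dead state. -/
def deadRow : Cmd :=
  loop rA rK (tableIndex ;; put rX rN rZero rN)

/-- The transitions from the state `rJ`, from those of the state `rSt`. -/
def tableRow : Cmd :=
  loop rA rK (tableIndex ;; get rVal rX rSt rZero ;;
    ifLt rA rVj (copy rVal rN)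
      (ifLt rVj rA skip (ifLt rVal rN (ifLt rJn rN (copy rVal rJn) skip) skip)) ;;
    put rX rJ rZero rVal)

/-- The transitions from the live states. The variable `rSt` holds the state reached by the first
`rJ` letters of `v` without the very first one. For `rJ = 0` it refers to the unused row `n + 1`,
whose entries `0` are the initial state. -/
def table : Cmd :=
  add rSt rN rOne ;; loop rJ rN (get rVj rZero rOne rJ ;; add rJn rJ rOne ;; tableRow ;;
    add rX rVj rN1 ;; add rX rX rOne ;; get rSt rX rSt rZero)

/-- The walks along palindromes of length `0` and `1`. -/
def shortWalks : Cmd :=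
  loop rS rN1 (put rOne rS rS rOne ;; loop rA rK (tableIndex ;; get rD rX rS rZero ;;
    get rP rTwo rD rS ;; add rP rP rOne ;; put rTwo rD rS rP))

/-- The contribution of the last letter `rA`, read in the state `rS`, to the walks along
palindromes of length `rL + 2`. -/
def extendLetter : Cmd :=
  loop rT rN1 (get rE rX rT rZero ;; get rP rLx rS rE ;; get rQ rLy rD rT ;; add rQ rQ rP ;;
    put rLy rD rT rQ)

/-- The contribution of the walks that read their last letter in the state `rS`. -/
def extendState : Cmd :=
  loop rA rK (tableIndex ;; get rD rX rS rZero ;; extendLetter)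

/-- The walks along longer palindromes. -/
def longWalks : Cmd :=
  loop rL rNm1 (add rLx rL rOne ;; add rLy rLx rTwo ;; loop rS rN1 extendState)

/-- The rank, from the numbers of closed walks: `rAcc` counts the closed walks at the state `rS`
and is added to `rNeg` in the next round. So `rNeg` collects the closed walks at the live states,
and `rAcc` ends with those at the dead state, which is the last one. -/
def result : Cmd :=
  const rAcc 0 ;; const rNeg 0 ;; loop rS rN1 (add rNeg rNeg rAcc ;; get rAcc rN1 rS rS ;;
    loop rA rK (tableIndex ;; get rD rX rS rZero ;; get rP rN rS rD ;; add rAcc rAcc rP)) ;;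
    sub rAcc rAcc rNeg ;; div rAcc rAcc rTwo

/-- The program, without the first and the last instructions. In the array, the cell `(0, 1, i)`
holds the letter `i` of `v`, the cell `(l + 1, s, t)` the number of walks from `t` to `s` along
palindromes of length `l`, and the cell `(a + n + 2, s, 0)` the transition from `s` by `a`. -/
def mainCmd : Cmd :=
  setup ;; copyIn ;; deadRow ;; table ;; shortWalks ;; longWalks ;; result

/-! ### Correctness of the program -/

/-- The letter number `i` of `v`, or `0` if there is none. -/
def letter {k : ℕ} (v : List (Fin k)) (i : ℕ) : ℕ := ((v[i]?).map Fin.val).getD 0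

/-- The variables that keep their values throughout the program. -/
structure Env (n k : ℕ) (σ : State) : Prop where
  len : σ.reg rN = n
  alph : σ.reg rK = k
  one : σ.reg rOne = 1
  zero : σ.reg rZero = 0
  two : σ.reg rTwo = 2
  thr : σ.reg rThr = 30
  n1 : σ.reg rN1 = n + 1
  nm1 : σ.reg rNm1 = n - 1

/-- The program does not assign the variables in `Env`. -/
def KeepsEnv (c : Cmd) : Bool :=
  [rN, rK, rOne, rZero, rTwo, rThr, rN1, rNm1].all fun y => decide (y ∉ c.writes)

theorem Env.of_agreeOff {n k : ℕ} {σ τ : State} (h : Env n k σ) {c : Cmd} (hc : AgreeOff c σ τ)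
    (hk : KeepsEnv c = true) : Env n k τ := by
  simp only [KeepsEnv, List.all_cons, List.all_nil, Bool.and_eq_true, decide_eq_true_eq] at hk
  obtain ⟨h1, h2, h3, h4, h5, h6, h7, h8, -⟩ := hk
  exact ⟨(hc _ h1).trans h.len, (hc _ h2).trans h.alph, (hc _ h3).trans h.one,
    (hc _ h4).trans h.zero, (hc _ h5).trans h.two, (hc _ h6).trans h.thr,
    (hc _ h7).trans h.n1, (hc _ h8).trans h.nm1⟩

/-- The bounds that keep the program safe: for the base `32 * n` of the addresses, all cells in use
have addresses of at most `B`, and the numbers of closed walks do not exceed `B`. -/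
structure Bounds (n k B : ℕ) : Prop where
  n_pos : 1 ≤ n
  k_pos : 1 ≤ k
  cell : (n + k + 3) * (32 * n) * (32 * n) ≤ B
  count : 2 * (n + 1) * k ^ n ≤ B

theorem Bounds.validCell {n k B : ℕ} (h : Bounds n k B) {x y z : ℕ} (hx : x ≤ n + k + 2)
    (hxy : 1 ≤ x ∨ 1 ≤ y) (hy : y ≤ n + 1) (hz : z ≤ n + 1) : ValidCell (32 * n) B x y z := by
  have hn := h.n_pos
  refine ⟨by omega, by omega, by omega, le_trans ?_ h.cell⟩
  have h1 : x * (32 * n) + y ≤ (x + 1) * (32 * n) - 1 := by rw [add_mul]; omega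
  have h2 : (x * (32 * n) + y) * (32 * n) + z ≤ (x + 1) * (32 * n) * (32 * n) := by
    have h3 : 1 ≤ (x + 1) * (32 * n) := Nat.mul_pos (by omega) (by omega)
    calc _ ≤ ((x + 1) * (32 * n) - 1) * (32 * n) + 32 * n := by
          refine Nat.add_le_add (Nat.mul_le_mul_right _ h1) (by omega)
      _ = ((x + 1) * (32 * n) - 1 + 1) * (32 * n) := by ring
      _ = _ := by rw [Nat.sub_add_cancel h3]
  exact h2.trans (Nat.mul_le_mul_right _ (Nat.mul_le_mul_right _ (by omega)))

theorem Bounds.small {n k B : ℕ} (h : Bounds n k B) : 1024 * (n + k + 3) ≤ B := by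
  have hn := h.n_pos
  refine le_trans ?_ h.cell
  calc 1024 * (n + k + 3) = (n + k + 3) * 32 * 32 := by ring
    _ ≤ _ := by gcongr <;> omega

/-- The first index of the array at the row of the letter `a` is put into `rX`. -/
theorem tableIndex_ev (σ : State) :
    tableIndex.ev σ = (σ.set rX (σ.reg rA + σ.reg rN1)).set rX
      (σ.reg rA + σ.reg rN1 + σ.reg rOne) := by
  simp [tableIndex, ev]

section Correct

variable {k B : ℕ} {v : List (Fin k)}

open scoped Classical in
/-- The array while the table is computed: the letters of `v` and the transitions for the pairs
`(s, a)` in `known`. All other cells hold `0`. -/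
noncomputable def tableHeap (v : List (Fin k)) (known : ℕ → ℕ → Prop) : ℕ → ℕ → ℕ → ℕ :=
  fun x y z =>
    if x = 0 ∧ y = 1 then letter v z
    else if v.length + 2 ≤ x ∧ z = 0 ∧ known y (x - (v.length + 2)) then
      natTransition v y (x - (v.length + 2))
    else 0

theorem tableHeap_table {known : ℕ → ℕ → Prop} {s a : ℕ} (h : known s a) :
    tableHeap v known (a + (v.length + 1) + 1) s 0 = natTransition v s a := by
  rw [tableHeap, if_neg (by omega), show a + (v.length + 1) + 1 - (v.length + 2) = a by omega,
    if_pos ⟨by omega, rfl, h⟩]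

theorem setHeap_tableHeap {σ : State} {known known' : ℕ → ℕ → Prop}
    (hσ : σ.heap = tableHeap v known) {s a : ℕ}
    (h : ∀ s' a', known' s' a' ↔ known s' a' ∨ s' = s ∧ a' = a) :
    (σ.setHeap (a + (v.length + 1) + 1) s 0 (natTransition v s a)).heap = tableHeap v known' := by
  obtain rfl : known' = fun s' a' => known s' a' ∨ s' = s ∧ a' = a := by
    funext s' a'
    exact propext (h s' a')
  funext x y z
  rw [State.setHeap_heap, hσ, tableHeap, tableHeap]
  by_cases h0 : x = 0 ∧ y = 1
  · rw [if_pos h0, if_pos h0, if_neg (by omega)]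
  rw [if_neg h0, if_neg h0]
  by_cases h1 : x = a + (v.length + 1) + 1 ∧ y = s ∧ z = 0
  · obtain ⟨rfl, rfl, rfl⟩ := h1
    have : a + (v.length + 1) + 1 - (v.length + 2) = a := by omega
    rw [if_pos ⟨rfl, rfl, rfl⟩, if_pos, this]
    exact ⟨by omega, rfl, Or.inr ⟨rfl, this⟩⟩
  · rw [if_neg h1]
    have e : v.length + 2 ≤ x ∧ z = 0 ∧ known y (x - (v.length + 2)) ↔ v.length + 2 ≤ x ∧ z = 0 ∧
        (known y (x - (v.length + 2)) ∨ y = s ∧ x - (v.length + 2) = a) :=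
      and_congr_right fun h2 => and_congr_right fun h3 => ⟨Or.inl, fun h4 =>
        h4.resolve_right fun h5 => h1 ⟨by omega, h5.1, h3⟩⟩
    by_cases h2 : v.length + 2 ≤ x ∧ z = 0 ∧ known y (x - (v.length + 2))
    · rw [if_pos h2, if_pos (e.1 h2)]
    · rw [if_neg h2, if_neg (mt e.2 h2)]

theorem copyIn_meets (hB : Bounds v.length k B) {σ : State} (hσ : Env v.length k σ)
    (hin : ∀ i, σ.input i = letter v (i - 2))
    (hheap : ∀ x y z, σ.heap x y z = if x = 0 ∧ y = 1 ∧ z < 30 then letter v z else 0) :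
    Meets (32 * v.length) B copyIn σ (v.length * (9 + 4) + 3)
      fun τ => τ.heap = tableHeap v fun _ _ => False := by
  have hsmall := hB.small
  refine (Meets.loop (T := 9) (N := v.length) (fun j τ => ∀ x y z,
    τ.heap x y z = if x = 0 ∧ y = 1 ∧ z < max 30 j then letter v z else 0) (by decide) hσ.len
    (by simpa using hheap) ?_).mono le_rfl ?_
  · intro j hj τ hτ hj' hinp hI
    have hE := hσ.of_agreeOff hτ (by decide)
    have hcell := hB.validCell (x := 0) (y := 1) (z := j) (by omega) (by omega) (by omega)
      (by omega)
    by_cases h30 : j < 30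
    · simp only [Meets, Safe, cost, ev, hE.thr, hj', h30, if_true, State.set_heap]
      refine ⟨trivial, by omega, ?_⟩
      rw [max_eq_left (by omega)]
      rwa [max_eq_left (by omega)] at hI
    · simp only [Meets, Safe, cost, ev, hE.thr, hj', h30, if_false, State.set_heap,
        State.setHeap_heap, State.set_reg, hE.two, hE.zero, hE.one, hI, hinp, hin, State.set_input,
        reduceCtorEq, if_true]
      refine ⟨⟨by omega, ⟨by omega, by omega⟩, hcell⟩, by omega, fun x y z => ?_⟩
      rw [max_eq_right (by omega), max_eq_right (by omega)]
      by_cases h : x = 0 ∧ y = 1 ∧ z = j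
      · rw [if_pos h, if_pos ⟨h.1, h.2.1, by omega⟩, h.2.2]
        rfl
      · rw [if_neg h]
        exact if_congr (by omega) rfl rfl
  · intro τ hτ
    funext x y z
    rw [hτ, tableHeap]
    simp only [and_false, if_false]
    by_cases h : x = 0 ∧ y = 1
    · rw [if_pos h]
      split_ifs with h'
      · rfl
      · rw [letter, List.getElem?_eq_none (by omega)]
        rfl
    · rw [if_neg h, if_neg (by omega)]

theorem deadRow_meets (hB : Bounds v.length k B) {σ : State} (hσ : Env v.length k σ)
    (hheap : σ.heap = tableHeap v fun _ _ => False) :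
    Meets (32 * v.length) B deadRow σ (k * (7 + 4) + 3)
      fun τ => τ.heap = tableHeap v fun s a => s = v.length ∧ a < k := by
  have hsmall := hB.small
  refine Meets.loop (T := 7) (N := k) (fun j τ =>
    τ.heap = tableHeap v fun s a => s = v.length ∧ a < j) (by decide) hσ.alph
    (by simpa using hheap) ?_
  intro j hj τ hτ hj' hinp hI
  have hE := hσ.of_agreeOff hτ (by decide)
  have hcell := hB.validCell (x := j + (v.length + 1) + 1) (y := v.length) (z := 0) (by omega)
    (by omega) (by omega) (by omega)
  have h := setHeap_tableHeap (a := j) (s := v.length)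
    (known' := fun s a => s = v.length ∧ a < j + 1) hI (by intros; omega)
  rw [natTransition_length v hj] at h
  simp only [Meets, Safe, cost, ev, tableIndex, hj', State.set_heap, State.set_reg, hE.len, hE.zero,
    hE.one, hE.n1, reduceCtorEq, if_true, if_false]
  refine ⟨⟨⟨by omega, by omega⟩, hcell⟩, by omega, ?_⟩
  rw [← h]
  rfl

/-- The state from which the row of the state `s` of the table is computed: the one reached by the
first `s` letters of `v` without the very first one. For `s = 0` it is a row of zeros. -/
noncomputable def fallback (v : List (Fin k)) (s : ℕ) : ℕ :=
  if s = 0 then v.length + 1 else stateOf v (v.take s).tail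

theorem fallback_le (v : List (Fin k)) (hv : v ≠ []) (s : ℕ) : fallback v s ≤ v.length + 1 := by
  rw [fallback]
  split_ifs
  · exact le_rfl
  · exact (stateOf_le hv _).trans (Nat.le_succ _)

theorem stateOf_nil (hv : v ≠ []) : stateOf v [] = 0 := by
  have h : Clean v [] := by
    rintro f ⟨j, hj, x, -, rfl⟩ h
    simpa using h.length_le
  rw [stateOf, if_pos h]
  refine border_eq (List.length_pos_iff.2 hv) (by simp) fun j hj h => ?_
  have := h.length_le
  simp only [List.length_take, List.length_nil] at this
  omega

/-- The entries of the row `fallback v s` lead to the fallback states of the successors of `s`. -/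
theorem tableHeap_fallback {known : ℕ → ℕ → Prop} {s a : ℕ} (hs : s < v.length) (ha : a < k)
    (h : ∀ s', s' = v.length ∨ s' < s → known s' a) (hz : ¬ known (v.length + 1) a) :
    tableHeap v known (a + (v.length + 1) + 1) (fallback v s) 0 =
      stateOf v (v.take s ++ [(⟨a, ha⟩ : Fin k)]).tail := by
  have hv : v ≠ [] := List.length_pos_iff.1 (by omega)
  rcases Nat.eq_zero_or_pos s with rfl | hs0
  · rw [fallback, if_pos rfl, tableHeap, if_neg (by omega), if_neg, List.take_zero]
    · exact (stateOf_nil hv).symm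
    · rw [show a + (v.length + 1) + 1 - (v.length + 2) = a by omega]
      exact fun h => hz h.2.2
  · have hne : v.take s ≠ [] := by
      rw [Ne, List.take_eq_nil_iff]
      rintro (h | h)
      · omega
      · exact hv h
    rw [fallback, if_neg (by omega), tableHeap_table, natTransition, dif_pos ha,
      ← stateOf_concat hv, List.tail_append_of_ne_nil hne]
    refine h _ ?_
    rw [stateOf]
    split_ifs
    · right
      have h1 := (take_border_suffix v (v.take s).tail).length_le
      have h2 := border_lt hv (v.take s).tail
      simp only [List.length_take, List.length_tail] at h1
      omega
    · exact Or.inl rfl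

theorem letter_eq {j : ℕ} (hj : j < v.length) : letter v j = v[j] := by
  rw [letter, List.getElem?_eq_getElem hj]
  rfl

theorem tableRow_meets (hB : Bounds v.length k B) {σ : State} (hσ : Env v.length k σ) {j : ℕ}
    (hj : j < v.length) (hJ : σ.reg rJ = j) (hJn : σ.reg rJn = j + 1)
    (hVj : σ.reg rVj = letter v j) (hSt : σ.reg rSt = fallback v j)
    (hheap : σ.heap = tableHeap v fun s a => (s = v.length ∨ s < j) ∧ a < k) :
    Meets (32 * v.length) B tableRow σ (k * (19 + 4) + 3)
      fun τ => τ.heap = tableHeap v fun s a => (s = v.length ∨ s < j + 1) ∧ a < k := by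
  have hsmall := hB.small
  have hv : v ≠ [] := List.length_pos_iff.1 (by omega)
  refine (Meets.loop (T := 19) (N := k) (fun a' τ =>
    τ.heap = tableHeap v fun s a => (s = v.length ∨ s < j) ∧ a < k ∨ s = j ∧ a < a') (by decide)
    hσ.alph (by simpa using hheap) ?_).mono le_rfl ?_
  · intro a ha τ hτ ha' hinp hI
    have hE := hσ.of_agreeOff hτ (by decide)
    have tJ := (hτ rJ (by decide)).trans hJ
    have tJn := (hτ rJn (by decide)).trans hJn
    have tVj := (hτ rVj (by decide)).trans hVj
    have tSt := (hτ rSt (by decide)).trans hSt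
    have hfb := fallback_le v hv j
    have hval := tableHeap_fallback
      (known := fun s a' => (s = v.length ∨ s < j) ∧ a' < k ∨ s = j ∧ a' < a) hj ha
      (fun s' h => Or.inl ⟨h, ha⟩) (by omega)
    have hnext : natTransition v j a = stateOf v (v.take j ++ [(⟨a, ha⟩ : Fin k)]) := by
      rw [natTransition, dif_pos ha, transition, if_pos hj]
    rw [stateOf_take_concat hj] at hnext
    have hlt : (⟨a, ha⟩ : Fin k) < v[j] ↔ a < letter v j := by rw [letter_eq hj]; rfl
    have heq : (⟨a, ha⟩ : Fin k) = v[j] ↔ a = letter v j := by rw [letter_eq hj, Fin.ext_iff]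
    simp only [hlt, heq] at hnext
    generalize stateOf v (v.take j ++ [(⟨a, ha⟩ : Fin k)]).tail = w at hval hnext
    rw [← hI] at hval
    have hcell := hB.validCell (x := a + (v.length + 1) + 1) (y := fallback v j) (z := 0)
      (by omega) (by omega) (by omega) (by omega)
    have hcell' := hB.validCell (x := a + (v.length + 1) + 1) (y := j) (z := 0)
      (by omega) (by omega) (by omega) (by omega)
    refine (Meets.seq_ev (T₁ := 2) (T₂ := 17) ?_ (by simp [tableIndex, cost]) (Meets.seq_ev
      (T₁ := 5) (T₂ := 12) ?_ (by simp [cost]) (Meets.seq (T₁ := 7) (T₂ := 5)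
      (Q₁ := fun τ' => τ'.heap = τ.heap ∧ τ'.reg rVal = natTransition v j a) ?_ ?_))).mono
      le_rfl fun _ h => h
    · simp only [tableIndex, Safe, ev, State.set_reg, reduceCtorEq, ha', hE.n1, hE.one, if_true,
        if_false]
      omega
    · simpa [tableIndex_ev, Safe, ha', hE.n1, hE.one, hE.zero, tSt] using hcell
    · simp only [tableIndex_ev, ev, State.set_reg, State.set_heap, reduceCtorEq, if_true, if_false,
        ha', hE.n1, hE.one, hE.zero, tSt, hval, Meets, Safe, cost, tVj, hE.len, tJn, hnext]
      by_cases h1 : a < letter v j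
      · simp [h1]
      · by_cases h2 : letter v j < a
        · simp [h1, h2, h2.ne']
        · obtain rfl : a = letter v j := by omega
          by_cases h3 : w < v.length
          · by_cases h4 : j + 1 < v.length
            · simp [h3, h4]
            · simp [h3, h4]
          · simp [h3]
    · rintro τ' hτ' - ⟨hh, hv'⟩
      have r : ∀ y, y ≠ rVal → τ'.reg y = ((tableIndex.ev τ).set rVal _).reg y := fun y hy =>
        hτ' y (by simpa [writes] using hy)
      have rX' := r rX (by decide)
      have rJ' := r rJ (by decide)
      have rZ' := r rZero (by decide)
      simp only [tableIndex_ev, State.set_reg, reduceCtorEq, if_true, if_false, ha', hE.n1, hE.one,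
        hE.zero, tJ] at rX' rJ' rZ'
      refine ⟨?_, le_rfl, ?_⟩
      · simpa [Safe, rX', rJ', rZ'] using hcell'
      · simp only [ev, rX', rJ', rZ', hv', State.set_heap]
        exact setHeap_tableHeap (hh.trans hI) (by intros; omega)
  · intro τ hτ
    rw [hτ]
    congr 1
    funext s a
    exact propext (by omega)

theorem table_meets (hB : Bounds v.length k B) {σ : State} (hσ : Env v.length k σ)
    (hheap : σ.heap = tableHeap v fun s a => s = v.length ∧ a < k) :
    Meets (32 * v.length) B table σ (1 + (v.length * (k * (19 + 4) + 16 + 4) + 3))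
      fun τ => τ.heap = tableHeap v fun s a => s < v.length + 1 ∧ a < k := by
  have hsmall := hB.small
  have hv : v ≠ [] := List.length_pos_iff.1 hB.n_pos
  refine Meets.seq_ev ?_ le_rfl ((Meets.loop (T := k * (19 + 4) + 16) (N := v.length) (fun j τ =>
    (τ.heap = tableHeap v fun s a => (s = v.length ∨ s < j) ∧ a < k) ∧
      τ.reg rSt = fallback v j) (by decide) ?_ ?_ ?_).mono le_rfl ?_)
  · simp only [Safe, hσ.len, hσ.one]
    omega
  · simp [ev, hσ.len]
  · simpa [ev, hσ.len, hσ.one, fallback] using hheap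
  · rintro j hj τ hτ hj' - ⟨hI, hSt⟩
    have hE : Env v.length k τ := by
      refine Env.of_agreeOff (σ := (add rSt rN rOne).ev σ) ?_ hτ (by decide)
      exact hσ.of_agreeOff (c := add rSt rN rOne) (fun y hy => ev_reg_of_notMem hy σ) (by decide)
    have hcell := hB.validCell (x := 0) (y := 1) (z := j) (by omega) (by omega) (by omega)
      (by omega)
    have hvj : tableHeap v (fun s a => (s = v.length ∨ s < j) ∧ a < k) 0 1 j = letter v j :=
      if_pos ⟨rfl, rfl⟩
    have hfb := fallback_le v hv j
    refine (Meets.seq_ev (T₁ := 5) ?_ (by simp [cost]) (Meets.seq_ev (T₁ := 1) ?_ (by simp [cost])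
      (Meets.seq (tableRow_meets (j := j) hB ?_ hj ?_ ?_ ?_ ?_ ?_) (T₂ := 7) ?_))).mono (by omega)
      fun _ h => h
    · simpa [Safe, hE.zero, hE.one, hj'] using hcell
    · simp only [Safe, ev, State.set_reg, reduceCtorEq, if_false, hj', hE.one]
      omega
    · exact ⟨hE.len, hE.alph, hE.one, hE.zero, hE.two, hE.thr, hE.n1, hE.nm1⟩
    · simpa [ev] using hj'
    · simp [ev, hj', hE.one]
    · simp [ev, hj', hE.one, hE.zero, hI, hvj]
    · simpa [ev] using hSt
    · simpa [ev] using hI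
    · intro τ' hτ' _ hI'
      have r : ∀ y, y ∉ tableRow.writes → y ≠ rVj → y ≠ rJn → τ'.reg y = τ.reg y := by
        intro y h1 h2 h3
        rw [hτ' y h1]
        simp [ev, h2, h3]
      have hvj' : τ'.reg rVj = letter v j := by
        rw [hτ' rVj (by decide)]
        simp [ev, hj', hE.one, hE.zero, hI, hvj]
      have hlt : letter v j < k := by rw [letter_eq hj]; exact v[j].2
      have hnext := tableHeap_fallback (known := fun s a => (s = v.length ∨ s < j + 1) ∧ a < k) hj
        hlt (by intros; omega) (by omega)
      have hstate : stateOf v (v.take j ++ [(⟨letter v j, hlt⟩ : Fin k)]).tail =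
          fallback v (j + 1) := by
        rw [fallback, if_neg (by omega), ← List.take_concat_get' v j hj]
        congr 3
        simp [letter_eq hj]
      have hcell' := hB.validCell (x := letter v j + (v.length + 1) + 1) (y := fallback v j)
        (z := 0) (by omega) (by omega) (by omega) (by omega)
      simp only [Meets, Safe, cost, ev, State.set_reg, State.set_heap, reduceCtorEq, if_true,
        if_false, hvj', r rN1 (by decide) (by decide) (by decide),
        r rOne (by decide) (by decide) (by decide), r rSt (by decide) (by decide) (by decide),
        r rZero (by decide) (by decide) (by decide), hE.n1, hE.one, hE.zero, hSt, hI', hnext,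
        hstate]
      exact ⟨⟨by omega, by omega, hcell'⟩, by omega, trivial, trivial⟩
  · rintro τ ⟨hτ, -⟩
    rw [hτ]
    congr 1
    funext s a
    exact propext (by omega)

end Correct

/-! ### Correctness of the counting part -/

/-- The array `h` with `F` added to its layer `x`. -/
def addLayer (h : ℕ → ℕ → ℕ → ℕ) (x : ℕ) (F : ℕ → ℕ → ℕ) : ℕ → ℕ → ℕ → ℕ :=
  fun x' y z => if x' = x then h x' y z + F y z else h x' y z

theorem addLayer_self (h : ℕ → ℕ → ℕ → ℕ) (x : ℕ) (F : ℕ → ℕ → ℕ) (y z : ℕ) :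
    addLayer h x F x y z = h x y z + F y z := if_pos rfl

theorem addLayer_of_ne (h : ℕ → ℕ → ℕ → ℕ) {x x' : ℕ} (hx : x' ≠ x) (F : ℕ → ℕ → ℕ) (y z : ℕ) :
    addLayer h x F x' y z = h x' y z := if_neg hx

theorem addLayer_zero (h : ℕ → ℕ → ℕ → ℕ) (x : ℕ) : (addLayer h x fun _ _ => 0) = h := by
  funext x' y z
  simp [addLayer]

theorem addLayer_addLayer (h : ℕ → ℕ → ℕ → ℕ) (x : ℕ) (F F' : ℕ → ℕ → ℕ) :
    addLayer (addLayer h x F) x F' = addLayer h x fun y z => F y z + F' y z := by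
  funext x' y z
  simp only [addLayer]
  split_ifs
  · rw [add_assoc]
  · rfl

theorem setHeap_addLayer {σ : State} {h : ℕ → ℕ → ℕ → ℕ} {x : ℕ} {F : ℕ → ℕ → ℕ}
    (hσ : σ.heap = addLayer h x F) (y z c : ℕ) :
    (σ.setHeap x y z (σ.heap x y z + c)).heap =
      addLayer h x fun y' z' => F y' z' + if y' = y ∧ z' = z then c else 0 := by
  funext x' y' z'
  rw [State.setHeap_heap, hσ]
  simp only [addLayer]
  by_cases hx : x' = x
  · by_cases hyz : y' = y ∧ z' = z
    · obtain ⟨rfl, rfl⟩ := hyz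
      simp [hx, add_assoc]
    · simp [hx, hyz]
  · simp [hx]

section Correct

variable {k B : ℕ} {v : List (Fin k)}

/-- The transition table is stored in the array `h`. -/
def HasTable (v : List (Fin k)) (h : ℕ → ℕ → ℕ → ℕ) : Prop :=
  ∀ s < v.length + 1, ∀ a < k, h (a + (v.length + 1) + 1) s 0 = natTransition v s a

theorem HasTable.addLayer {h : ℕ → ℕ → ℕ → ℕ} (hh : HasTable v h) {x : ℕ} (hx : x ≤ v.length + 1)
    (F : ℕ → ℕ → ℕ) : HasTable v (addLayer h x F) := fun s hs a ha => by
  rw [addLayer_of_ne _ (by omega), hh s hs a ha]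

theorem shortWalks_meets (hB : Bounds v.length k B) {σ : State} (hσ : Env v.length k σ)
    (htab : HasTable v σ.heap) (hzero : ∀ l ≤ v.length, ∀ y z, σ.heap (l + 1) y z = 0) :
    Meets (32 * v.length) B shortWalks σ ((v.length + 1) * (k * (18 + 4) + 8 + 4) + 3) fun τ =>
      HasTable v τ.heap ∧
      (∀ l < 2, ∀ y z, z < v.length + 1 →
        τ.heap (l + 1) y z = walkCount (natTransition v) k (v.length + 1) l y z) ∧
      ∀ l, 2 ≤ l → l ≤ v.length → ∀ y z, τ.heap (l + 1) y z = 0 := by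
  have hsmall := hB.small
  have hn := hB.n_pos
  have hv : v ≠ [] := List.length_pos_iff.1 hn
  refine (Meets.loop (T := k * (18 + 4) + 8) (N := v.length + 1) (fun s τ =>
    HasTable v τ.heap ∧
    (∀ y z, τ.heap 1 y z = if z = y ∧ z < s then 1 else 0) ∧
    (∀ y z, τ.heap 2 y z = if z < s then ∑ a ∈ Finset.range k,
      if natTransition v z a = y then 1 else 0 else 0) ∧
    ∀ l, 2 ≤ l → l ≤ v.length → ∀ y z, τ.heap (l + 1) y z = 0) (by decide)
    hσ.n1 ?_ ?_).mono le_rfl ?_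
  · refine ⟨htab, fun y z => ?_, fun y z => ?_, fun l _ => hzero l⟩
    · simpa using hzero 0 (by omega) y z
    · simpa using hzero 1 hn y z
  · rintro s hs τ hτ hs' - ⟨h1, h2, h3, h4⟩
    have hE := hσ.of_agreeOff hτ (by decide)
    have hcell := hB.validCell (x := 1) (y := s) (z := s) (by omega) (by omega) (by omega)
      (by omega)
    have hE1 : Env v.length k ((put rOne rS rS rOne).ev τ) :=
      ⟨hE.len, hE.alph, hE.one, hE.zero, hE.two, hE.thr, hE.n1, hE.nm1⟩
    have hput : ∀ x y z, ((put rOne rS rS rOne).ev τ).heap x y z =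
        if x = 1 ∧ y = s ∧ z = s then 1 else τ.heap x y z := by
      intro x y z
      simp only [ev, State.setHeap_heap, hE.one, hs']
    set τ₁ := (put rOne rS rS rOne).ev τ with hτ₁
    have hs1 : τ₁.reg rS = s := hs'
    refine (Meets.seq_ev (T₁ := 5) (T₂ := k * (18 + 4) + 3) (by simpa [Safe, hE.one, hs'] using
      hcell) (by simp [cost]) ((Meets.loop (T := 18) (N := k) (fun a τ' =>
        τ'.heap = addLayer τ₁.heap 2 fun y z =>
          ∑ a' ∈ Finset.range a, if y = natTransition v s a' ∧ z = s then 1 else 0)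
        (by decide) hE1.alph ?_ ?_).mono le_rfl fun _ h => h)).mono (by omega) ?_
    · simp [addLayer_zero]
    · intro a ha τ' hτ' ha' _ hI
      have hE2 := hE1.of_agreeOff hτ' (by decide)
      have hs2 : τ'.reg rS = s := (hτ' rS (by decide)).trans hs1
      have ht : τ'.heap (a + (v.length + 1) + 1) s 0 = natTransition v s a := by
        rw [hI, addLayer_of_ne _ (by omega), hput, if_neg (by omega), h1 s hs a ha]
      have hd := natTransition_lt hv s ha
      have hcell1 := hB.validCell (x := a + (v.length + 1) + 1) (y := s) (z := 0) (by omega)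
        (by omega) (by omega) (by omega)
      have hcell2 := hB.validCell (x := 2) (y := natTransition v s a) (z := s) (by omega)
        (by omega) (by omega) (by omega)
      have h0 : τ₁.heap 2 (natTransition v s a) s = 0 := by
        rw [hput, if_neg (by omega), h3, if_neg (lt_irrefl _)]
      have hval : τ'.heap 2 (natTransition v s a) s ≤ a := by
        rw [hI, addLayer_self, h0, zero_add]
        refine (Finset.sum_le_card_nsmul _ _ 1 fun _ _ => ?_).trans (by simp)
        split_ifs <;> omega
      have hset := setHeap_addLayer hI (natTransition v s a) s 1
      simp only [Meets, Safe, cost, ev, tableIndex, State.set_reg, State.set_heap, reduceCtorEq,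
        if_true, if_false, ha', hE2.n1, hE2.one, hE2.zero, hE2.two, hs2, ht]
      refine ⟨⟨⟨by omega, by omega⟩, hcell1, hcell2, by omega, hcell2⟩, by omega, ?_⟩
      simp only [Finset.sum_range_succ]
      rw [← hset]
      rfl
    · intro τ' hτ'
      rw [State.set_heap, hτ']
      refine ⟨fun s' hs' a ha => ?_, fun y z => ?_, fun y z => ?_, fun l hl hl' y z => ?_⟩
      · rw [addLayer_of_ne _ (by omega), hput, if_neg (by omega), h1 s' hs' a ha]
      · rw [addLayer_of_ne _ (by omega), hput, h2]
        by_cases h : z = y ∧ z < s + 1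
        · rw [if_pos h]
          by_cases h' : z = s
          · rw [if_pos (by omega)]
          · rw [if_neg (by omega), if_pos (by omega)]
        · rw [if_neg h, if_neg (by omega), if_neg (by omega)]
      · rw [addLayer_self, hput, if_neg (by omega), h3]
        by_cases h : z = s
        · subst h
          rw [if_neg (by omega), if_pos (by omega), zero_add]
          exact Finset.sum_congr rfl fun a _ => if_congr (by simp [eq_comm]) rfl rfl
        · have h0 : ∑ a ∈ Finset.range k, (if y = natTransition v s a ∧ z = s then 1 else 0) = 0 :=
            Finset.sum_eq_zero fun a _ => if_neg fun h' => h h'.2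
          rw [h0, add_zero]
          exact if_congr (by omega) rfl rfl
      · rw [addLayer_of_ne _ (by omega), hput, if_neg (by omega), h4 l hl hl']
  · rintro τ ⟨h1, h2, h3, h4⟩
    refine ⟨h1, fun l hl y z hz => ?_, h4⟩
    interval_cases l
    · rw [h2, walkCount]
      exact if_congr (by omega) rfl rfl
    · rw [h3, walkCount, if_pos hz]

/-- The walks that read the last letter `a` in the state `s'` and start in the state `t < N`,
as a contribution to the walks from `z` to `y`; `W` counts the walks along shorter palindromes. -/
noncomputable def contribution (v : List (Fin k)) (W : ℕ → ℕ → ℕ) (s a N y z : ℕ) : ℕ :=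
  ∑ t ∈ Finset.range N, if y = natTransition v s a ∧ z = t then W s (natTransition v t a) else 0

theorem extendLetter_meets (hB : Bounds v.length k B) {σ : State} (hσ : Env v.length k σ)
    {l s a : ℕ} (hl : l + 2 ≤ v.length) (hs : s < v.length + 1) (ha : a < k)
    (hX : σ.reg rX = a + (v.length + 1) + 1) (hD : σ.reg rD = natTransition v s a)
    (hS : σ.reg rS = s) (hLx : σ.reg rLx = l + 1) (hLy : σ.reg rLy = l + 3)
    (htab : HasTable v σ.heap)
    (hbound : ∀ y z, σ.heap (l + 3) y z +
      contribution v (σ.heap (l + 1)) s a (v.length + 1) y z ≤ B) :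
    Meets (32 * v.length) B extendLetter σ ((v.length + 1) * (21 + 4) + 3) fun τ =>
      τ.heap = addLayer σ.heap (l + 3) (contribution v (σ.heap (l + 1)) s a (v.length + 1)) := by
  have hsmall := hB.small
  have hv : v ≠ [] := List.length_pos_iff.1 hB.n_pos
  refine Meets.loop (T := 21) (N := v.length + 1) (fun t τ =>
    τ.heap = addLayer σ.heap (l + 3) (contribution v (σ.heap (l + 1)) s a t)) (by decide)
    hσ.n1 ?_ ?_
  · exact (addLayer_zero _ _).symm
  · intro t ht τ hτ ht' _ hI
    have hE := hσ.of_agreeOff hτ (by decide)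
    have tX := (hτ rX (by decide)).trans hX
    have tD := (hτ rD (by decide)).trans hD
    have tS := (hτ rS (by decide)).trans hS
    have tLx := (hτ rLx (by decide)).trans hLx
    have tLy := (hτ rLy (by decide)).trans hLy
    have hd := natTransition_lt hv s ha
    have hd' := natTransition_lt hv t ha
    have h1 : τ.heap (a + (v.length + 1) + 1) t 0 = natTransition v t a := by
      rw [hI]
      exact htab.addLayer (by omega) _ t ht a ha
    have h2 : τ.heap (l + 1) s (natTransition v t a) =
        σ.heap (l + 1) s (natTransition v t a) := by
      rw [hI, addLayer_of_ne _ (by omega)]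
    have hcell1 := hB.validCell (x := a + (v.length + 1) + 1) (y := t) (z := 0) (by omega)
      (by omega) (by omega) (by omega)
    have hcell2 := hB.validCell (x := l + 1) (y := s) (z := natTransition v t a) (by omega)
      (by omega) (by omega) (by omega)
    have hcell3 := hB.validCell (x := l + 3) (y := natTransition v s a) (z := t) (by omega)
      (by omega) (by omega) (by omega)
    have hset := setHeap_addLayer hI (natTransition v s a) t
      (σ.heap (l + 1) s (natTransition v t a))
    have hle : τ.heap (l + 3) (natTransition v s a) t +
        σ.heap (l + 1) s (natTransition v t a) ≤ B := by
      refine le_trans ?_ (hbound (natTransition v s a) t)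
      rw [hI, addLayer_self, add_assoc]
      refine Nat.add_le_add_left ?_ _
      calc _ = contribution v (σ.heap (l + 1)) s a (t + 1) (natTransition v s a) t := by
            rw [contribution, contribution, Finset.sum_range_succ, if_pos ⟨rfl, rfl⟩]
        _ ≤ _ := Finset.sum_le_sum_of_subset (Finset.range_subset_range.2 (by omega))
    simp only [Meets, Safe, cost, ev, State.set_reg, State.set_heap, reduceCtorEq,
      if_true, if_false, ht', hE.zero, tX, tD, tS, tLx, tLy, h1, h2]
    refine ⟨⟨hcell1, hcell2, hcell3, hle, hcell3⟩, by omega, ?_⟩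
    have hsucc : contribution v (σ.heap (l + 1)) s a (t + 1) = fun y z =>
        contribution v (σ.heap (l + 1)) s a t y z +
          if y = natTransition v s a ∧ z = t then σ.heap (l + 1) s (natTransition v t a)
          else 0 := by
      funext y z
      rw [contribution, Finset.sum_range_succ, contribution]
    rw [hsucc]
    exact hset

theorem extendState_meets (hB : Bounds v.length k B) {σ : State} (hσ : Env v.length k σ)
    {l s : ℕ} (hl : l + 2 ≤ v.length) (hs : s < v.length + 1)
    (hS : σ.reg rS = s) (hLx : σ.reg rLx = l + 1) (hLy : σ.reg rLy = l + 3)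
    (htab : HasTable v σ.heap)
    (hbound : ∀ y z, σ.heap (l + 3) y z + ∑ a ∈ Finset.range k,
      contribution v (σ.heap (l + 1)) s a (v.length + 1) y z ≤ B) :
    Meets (32 * v.length) B extendState σ (k * ((v.length + 1) * (21 + 4) + 10 + 4) + 3) fun τ =>
      τ.heap = addLayer σ.heap (l + 3) fun y z => ∑ a ∈ Finset.range k,
        contribution v (σ.heap (l + 1)) s a (v.length + 1) y z := by
  have hsmall := hB.small
  have hv : v ≠ [] := List.length_pos_iff.1 hB.n_pos
  refine Meets.loop (T := (v.length + 1) * (21 + 4) + 10) (N := k) (fun a τ =>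
    τ.heap = addLayer σ.heap (l + 3) fun y z => ∑ a' ∈ Finset.range a,
      contribution v (σ.heap (l + 1)) s a' (v.length + 1) y z) (by decide)
    hσ.alph ?_ ?_
  · exact (addLayer_zero _ _).symm
  · intro a ha τ hτ ha' _ hI
    have hE := hσ.of_agreeOff hτ (by decide)
    have tS := (hτ rS (by decide)).trans hS
    have tLx := (hτ rLx (by decide)).trans hLx
    have tLy := (hτ rLy (by decide)).trans hLy
    have ht : HasTable v τ.heap := by
      rw [hI]
      exact htab.addLayer (by omega) _
    have hcell := hB.validCell (x := a + (v.length + 1) + 1) (y := s) (z := 0) (by omega)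
      (by omega) (by omega) (by omega)
    have h1 : τ.heap (l + 1) = σ.heap (l + 1) := by
      rw [hI]
      funext y z
      exact addLayer_of_ne _ (by omega) _ _ _
    refine (Meets.seq_ev (T₁ := 2) ?_ (by simp [tableIndex, cost]) (Meets.seq_ev (T₁ := 5) ?_
      (by simp [cost]) (extendLetter_meets (l := l) (s := s) (a := a) hB ?_ hl hs ha ?_ ?_ ?_ ?_ ?_
        ?_ ?_))).mono (by omega) ?_
    · simp only [tableIndex, Safe, ev, State.set_reg, reduceCtorEq, ha', hE.n1, hE.one, if_true,
        if_false]
      omega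
    · simpa [tableIndex_ev, Safe, ha', hE.n1, hE.one, hE.zero, tS] using hcell
    · exact ⟨hE.len, hE.alph, hE.one, hE.zero, hE.two, hE.thr, hE.n1, hE.nm1⟩
    · simp [tableIndex_ev, ev, ha', hE.n1, hE.one]
    · simp [tableIndex_ev, ev, ha', hE.n1, hE.one, hE.zero, tS, ht s hs a ha]
    · simpa [tableIndex_ev, ev] using tS
    · simpa [tableIndex_ev, ev] using tLx
    · simpa [tableIndex_ev, ev] using tLy
    · simpa [tableIndex_ev, ev] using ht
    · intro y z
      simp only [tableIndex_ev, ev, State.set_heap, h1]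
      refine le_trans ?_ (hbound y z)
      rw [hI, addLayer_self, add_assoc, ← Finset.sum_range_succ]
      exact Nat.add_le_add_left
        (Finset.sum_le_sum_of_subset (Finset.range_subset_range.2 (by omega))) _
    · intro τ' hτ'
      rw [State.set_heap, hτ']
      simp only [tableIndex_ev, ev, State.set_heap, h1, Finset.sum_range_succ]
      rw [hI, addLayer_addLayer]

/-- Summed over all states and letters, the contributions give the recursion of `walkCount`. -/
theorem sum_contribution {l : ℕ} {W : ℕ → ℕ → ℕ} (hv : v ≠ [])
    (hW : ∀ y z, z < v.length + 1 → W y z = walkCount (natTransition v) k (v.length + 1) l y z)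
    (y z : ℕ) :
    ∑ s ∈ Finset.range (v.length + 1), ∑ a ∈ Finset.range k,
      contribution v W s a (v.length + 1) y z =
    if z < v.length + 1 then walkCount (natTransition v) k (v.length + 1) (l + 2) y z else 0 := by
  split_ifs with hz
  · rw [walkCount]
    refine Finset.sum_congr rfl fun s hs => Finset.sum_congr rfl fun a ha => ?_
    rw [contribution, Finset.sum_eq_single_of_mem z (Finset.mem_range.2 hz),
      hW _ _ (natTransition_lt hv z (Finset.mem_range.1 ha))]
    · exact if_congr (by simp [eq_comm]) rfl rfl
    · exact fun t _ ht => if_neg fun h => ht h.2.symm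
  · refine Finset.sum_eq_zero fun s _ => Finset.sum_eq_zero fun a _ =>
      Finset.sum_eq_zero fun t ht => if_neg fun h => hz ?_
    rw [h.2]
    exact Finset.mem_range.1 ht

theorem walkCount_natTransition_le (hv : v ≠ []) (l s : ℕ) {t : ℕ} (ht : t < v.length + 1) :
    walkCount (natTransition v) k (v.length + 1) l s t ≤ k ^ l :=
  walkCount_le (fun s _ _ ha => natTransition_lt hv s ha) l s ht

theorem longWalks_meets (hB : Bounds v.length k B) {σ : State} (hσ : Env v.length k σ)
    (htab : HasTable v σ.heap)
    (hshort : ∀ l < 2, ∀ y z, z < v.length + 1 →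
      σ.heap (l + 1) y z = walkCount (natTransition v) k (v.length + 1) l y z)
    (hzero : ∀ l, 2 ≤ l → l ≤ v.length → ∀ y z, σ.heap (l + 1) y z = 0) :
    Meets (32 * v.length) B longWalks σ
      ((v.length - 1) * ((v.length + 1) * (k * ((v.length + 1) * (21 + 4) + 10 + 4) + 3 + 4) + 5 +
        4) + 3) fun τ =>
      HasTable v τ.heap ∧ ∀ l ≤ v.length, ∀ y z, z < v.length + 1 →
        τ.heap (l + 1) y z = walkCount (natTransition v) k (v.length + 1) l y z := by
  have hsmall := hB.small
  have hn := hB.n_pos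
  have hv : v ≠ [] := List.length_pos_iff.1 hn
  refine (Meets.loop (T := (v.length + 1) * (k * ((v.length + 1) * (21 + 4) + 10 + 4) + 3 + 4) + 5)
    (N := v.length - 1) (fun l τ => HasTable v τ.heap ∧
    (∀ l' < l + 2, ∀ y z, z < v.length + 1 →
      τ.heap (l' + 1) y z = walkCount (natTransition v) k (v.length + 1) l' y z) ∧
    ∀ l', l + 2 ≤ l' → l' ≤ v.length → ∀ y z, τ.heap (l' + 1) y z = 0) (by decide) hσ.nm1
    ⟨htab, hshort, hzero⟩ ?_).mono le_rfl ?_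
  · rintro l hl τ hτ hl' - ⟨h1, h2, h3⟩
    have hE := hσ.of_agreeOff hτ (by decide)
    have hsum := sum_contribution (l := l) (W := τ.heap (l + 1)) hv (h2 l (by omega))
    have hle : ∀ y z, ∑ s ∈ Finset.range (v.length + 1), ∑ a ∈ Finset.range k,
        contribution v (τ.heap (l + 1)) s a (v.length + 1) y z ≤ B := by
      intro y z
      rw [hsum]
      split_ifs with hz
      · calc _ ≤ k ^ (l + 2) := walkCount_natTransition_le hv _ _ hz
          _ ≤ k ^ v.length := Nat.pow_le_pow_right hB.k_pos (by omega)
          _ ≤ 2 * (v.length + 1) * k ^ v.length := Nat.le_mul_of_pos_left _ (by omega)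
          _ ≤ B := hB.count
      · exact Nat.zero_le _
    refine (Meets.seq_ev (T₁ := 1) ?_ (by simp [cost]) (Meets.seq_ev (T₁ := 1) ?_
      (by simp [cost]) (Meets.loop (T := k * ((v.length + 1) * (21 + 4) + 10 + 4) + 3)
        (N := v.length + 1) (fun s τ' => τ'.heap = addLayer τ.heap (l + 3) fun y z =>
          ∑ s' ∈ Finset.range s, ∑ a ∈ Finset.range k,
            contribution v (τ.heap (l + 1)) s' a (v.length + 1) y z) (by decide) ?_ ?_ ?_))).mono
      (by omega) ?_
    · simp only [Safe, hl', hE.one]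
      omega
    · simp only [Safe, ev, State.set_reg, reduceCtorEq, if_true, if_false, hl', hE.one, hE.two]
      omega
    · simpa [ev] using hE.n1
    · simp [ev, addLayer_zero]
    · intro s hs τ' hτ' hs' _ hI
      have r : ∀ y, y ∉ (loop rS rN1 extendState).writes → y ≠ rLx → y ≠ rLy →
          τ'.reg y = τ.reg y := by
        intro y h1 h2 h3
        rw [hτ' y h1]
        simp [ev, h2, h3]
      have hE' : Env v.length k τ' :=
        ⟨(r _ (by decide) (by decide) (by decide)).trans hE.len,
          (r _ (by decide) (by decide) (by decide)).trans hE.alph,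
          (r _ (by decide) (by decide) (by decide)).trans hE.one,
          (r _ (by decide) (by decide) (by decide)).trans hE.zero,
          (r _ (by decide) (by decide) (by decide)).trans hE.two,
          (r _ (by decide) (by decide) (by decide)).trans hE.thr,
          (r _ (by decide) (by decide) (by decide)).trans hE.n1,
          (r _ (by decide) (by decide) (by decide)).trans hE.nm1⟩
      have hW : τ'.heap (l + 1) = τ.heap (l + 1) := by
        rw [hI]
        funext y z
        exact addLayer_of_ne _ (by omega) _ _ _
      refine (extendState_meets (l := l) (s := s) hB hE' (by omega) hs hs' ?_ ?_ ?_ ?_).mono le_rfl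
        ?_
      · rw [hτ' rLx (by decide)]
        simp [ev, hl', hE.one]
      · rw [hτ' rLy (by decide)]
        simp [ev, hl', hE.one, hE.two]
      · rw [hI]
        exact h1.addLayer (by omega) _
      · intro y z
        rw [hW, hI, addLayer_self, h3 (l + 2) le_rfl (by omega), zero_add, ← Finset.sum_range_succ
          (fun s => ∑ a ∈ Finset.range k,
            contribution v (τ.heap (l + 1)) s a (v.length + 1) y z)]
        exact (Finset.sum_le_sum_of_subset (Finset.range_subset_range.2 (by omega))).trans
          (hle y z)
      · intro τ'' hτ''
        rw [State.set_heap, hτ'', hW, hI, addLayer_addLayer]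
        simp only [Finset.sum_range_succ]
    · intro τ' hτ'
      rw [State.set_heap, hτ']
      refine ⟨h1.addLayer (by omega) _, fun l' hl'' y z hz => ?_, fun l' h5 h6 y z => ?_⟩
      · rcases Nat.lt_or_ge l' (l + 2) with h | h
        · rw [addLayer_of_ne _ (by omega), h2 l' h y z hz]
        · obtain rfl : l' = l + 2 := by omega
          rw [addLayer_self, h3 (l + 2) le_rfl (by omega), zero_add, hsum, if_pos hz]
      · rw [addLayer_of_ne _ (by omega), h3 l' (by omega) h6]
  · rintro τ ⟨h1, h2, -⟩
    exact ⟨h1, fun l hl => h2 l (by omega)⟩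

theorem result_meets (hB : Bounds v.length k B) {σ : State} (hσ : Env v.length k σ)
    (htab : HasTable v σ.heap)
    (hwalks : ∀ l ≤ v.length, ∀ y z, z < v.length + 1 →
      σ.heap (l + 1) y z = walkCount (natTransition v) k (v.length + 1) l y z) :
    Meets (32 * v.length) B result σ ((v.length + 1) * (k * (13 + 4) + 9 + 4) + 7) fun τ =>
      τ.reg rAcc = RP v := by
  have hsmall := hB.small
  have hn := hB.n_pos
  have hv : v ≠ [] := List.length_pos_iff.1 hn
  set W := closedWalkCount (natTransition v) k (v.length + 1) v.length with hW
  have hpart : ∀ s < v.length + 1, ∀ a ≤ k,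
      walkCount (natTransition v) k (v.length + 1) v.length s s + ∑ a ∈ Finset.range a,
        walkCount (natTransition v) k (v.length + 1) (v.length - 1) s (natTransition v s a) ≤
          2 * k ^ v.length := by
    intro s hs a ha
    have h1 := walkCount_natTransition_le hv v.length s hs
    have h2 : ∑ a ∈ Finset.range a, walkCount (natTransition v) k (v.length + 1) (v.length - 1) s
        (natTransition v s a) ≤ k ^ v.length := by
      calc _ ≤ a * k ^ (v.length - 1) := by
            refine (Finset.sum_le_card_nsmul _ _ (k ^ (v.length - 1)) fun a' ha' => ?_).trans_eq
              (by rw [Finset.card_range, smul_eq_mul])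
            exact walkCount_natTransition_le hv _ _
              (natTransition_lt hv s ((Finset.mem_range.1 ha').trans_le ha))
        _ ≤ k * k ^ (v.length - 1) := Nat.mul_le_mul_right _ ha
        _ = k ^ v.length := by rw [← pow_succ', Nat.sub_add_cancel hn]
    omega
  have hWsum : ∀ s ≤ v.length + 1, ∑ s' ∈ Finset.range s, W s' ≤ B := by
    intro s hs
    refine le_trans ?_ hB.count
    calc _ ≤ s * (2 * k ^ v.length) := by
          refine (Finset.sum_le_card_nsmul _ _ (2 * k ^ v.length) fun s' hs' => ?_).trans_eq
            (by rw [Finset.card_range, smul_eq_mul])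
          exact hpart s' ((Finset.mem_range.1 hs').trans_le hs) k le_rfl
      _ ≤ (v.length + 1) * (2 * k ^ v.length) := Nat.mul_le_mul_right _ hs
      _ = _ := by ring
  have hloop := fun (σ' : State) (hσ' : Env v.length k σ') (hh : σ'.heap = σ.heap)
      (h0 : σ'.reg rAcc = 0) (h1 : σ'.reg rNeg = 0) =>
    Meets.loop (M := 32 * v.length) (B := B) (σ := σ') (i := rS) (b := rN1)
      (c := add rNeg rNeg rAcc ;; Cmd.get rAcc rN1 rS rS ;;
        loop rA rK (tableIndex ;; Cmd.get rD rX rS rZero ;; Cmd.get rP rN rS rD ;;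
          add rAcc rAcc rP))
      (T := k * (13 + 4) + 9) (N := v.length + 1)
      (fun s τ => τ.heap = σ.heap ∧ τ.reg rNeg + τ.reg rAcc = ∑ s' ∈ Finset.range s, W s' ∧
        ∀ s', s = s' + 1 → τ.reg rAcc = W s') (by decide) hσ'.n1
      (by simp [hh, h0, h1]) (by
        rintro s hs τ hτ hs' - ⟨hI1, hI2, -⟩
        have hE := hσ'.of_agreeOff hτ (by decide)
        have hcell := hB.validCell (x := v.length + 1) (y := s) (z := s) (by omega) (by omega)
          (by omega) (by omega)
        have hself : τ.heap (v.length + 1) s s =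
            walkCount (natTransition v) k (v.length + 1) v.length s s := by
          rw [hI1, hwalks _ le_rfl _ _ hs]
        refine (Meets.seq_ev (T₁ := 1) ?_ (by simp [cost]) (Meets.seq_ev (T₁ := 5) ?_
          (by simp [cost]) (Meets.loop (T := 13) (N := k) (fun a τ' => τ'.heap = σ.heap ∧
            τ'.reg rNeg = ∑ s' ∈ Finset.range s, W s' ∧ τ'.reg rAcc =
              walkCount (natTransition v) k (v.length + 1) v.length s s +
              ∑ a ∈ Finset.range a, walkCount (natTransition v) k (v.length + 1) (v.length - 1) s
                (natTransition v s a)) (by decide) ?_ ?_ ?_))).mono (by omega) ?_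
        · simp only [Safe, hI2]
          exact hWsum s (by omega)
        · simpa [Safe, ev, hE.n1, hs'] using hcell
        · simpa [ev] using hE.alph
        · simp [ev, hI1, hI2, hE.n1, hs', ← hself]
        · rintro a ha τ' hτ' ha' - ⟨hJ1, hJ2, hJ3⟩
          have r : ∀ y, y ∉ (loop rA rK (tableIndex ;; Cmd.get rD rX rS rZero ;;
              Cmd.get rP rN rS rD ;; add rAcc rAcc rP)).writes → y ≠ rNeg → y ≠ rAcc →
              τ'.reg y = τ.reg y := by
            intro y h1 h2 h3
            rw [hτ' y h1]
            simp [ev, h2, h3]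
          have rS' := (r rS (by decide) (by decide) (by decide)).trans hs'
          have rN' := (r rN (by decide) (by decide) (by decide)).trans hE.len
          have rN1' := (r rN1 (by decide) (by decide) (by decide)).trans hE.n1
          have rOne' := (r rOne (by decide) (by decide) (by decide)).trans hE.one
          have rZero' := (r rZero (by decide) (by decide) (by decide)).trans hE.zero
          have hd := natTransition_lt hv s ha
          have ht : τ'.heap (a + (v.length + 1) + 1) s 0 = natTransition v s a := by
            rw [hJ1, htab s hs a ha]
          have hw : τ'.heap v.length s (natTransition v s a) =
              walkCount (natTransition v) k (v.length + 1) (v.length - 1) s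
                (natTransition v s a) := by
            rw [hJ1, ← hwalks _ (by omega) _ _ hd, Nat.sub_add_cancel hn]
          have hcell1 := hB.validCell (x := a + (v.length + 1) + 1) (y := s) (z := 0) (by omega)
            (by omega) (by omega) (by omega)
          have hcell2 := hB.validCell (x := v.length) (y := s) (z := natTransition v s a) (by omega)
            (by omega) (by omega) (by omega)
          have hle := (hpart s hs (a + 1) ha).trans (le_trans
            (Nat.mul_le_mul_right _ (Nat.le_mul_of_pos_right 2 (by omega))) hB.count)
          rw [Finset.sum_range_succ, ← add_assoc] at hle
          simp only [Meets, Safe, cost, ev, tableIndex, State.set_reg, State.set_heap, reduceCtorEq,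
            if_true, if_false, ha', rS', rN', rN1', rOne', rZero', ht, hw, hJ1, hJ2, hJ3]
          refine ⟨⟨⟨by omega, by omega⟩, hcell1, hcell2, hle⟩, by omega, trivial, trivial, ?_⟩
          rw [Finset.sum_range_succ, add_assoc]
        · rintro τ' ⟨hJ1, hJ2, hJ3⟩
          have hWs : τ'.reg rAcc = W s := hJ3
          refine ⟨hJ1, ?_, fun s' h => ?_⟩
          · simp only [State.set_reg, reduceCtorEq, if_false, hJ2, hWs, Finset.sum_range_succ]
          · obtain rfl : s = s' := by omega
            simpa using hWs)
  refine (Meets.seq_ev (T₁ := 1) (Nat.zero_le _) (by simp [cost]) (Meets.seq_ev (T₁ := 1)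
    (Nat.zero_le _) (by simp [cost]) (Meets.seq (hloop _ ?_ ?_ ?_ ?_) (T₂ := 2) ?_))).mono
    (by omega) fun _ h => h
  · exact ⟨hσ.len, hσ.alph, hσ.one, hσ.zero, hσ.two, hσ.thr, hσ.n1, hσ.nm1⟩
  · rfl
  · simp [ev]
  · simp [ev]
  · rintro τ hτ - ⟨-, h1, h2⟩
    have h2 := h2 _ rfl
    have hRP := two_mul_RP_add_sum_closedWalkCount hv
    rw [h2, Finset.sum_range_succ] at h1
    have htwo : τ.reg rTwo = 2 := (hτ rTwo (by decide)).trans hσ.two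
    simp only [Meets, Safe, cost, ev, State.set_reg, reduceCtorEq, if_true, if_false, htwo, h2]
    refine ⟨⟨trivial, trivial⟩, by omega, ?_⟩
    have h3 : 2 * RP v + ∑ s ∈ Finset.range v.length, W s = W v.length := hRP
    omega

end Correct

section Main

variable {k B : ℕ} {v : List (Fin k)}

/-- The time is dominated by the loops of `longWalks`, nested over lengths, states, letters and
states. -/
theorem mainCmd_meets (hB : Bounds v.length k B) {σ : State} (hN : σ.reg rN = v.length)
    (hK : σ.reg rK = k) (hin : ∀ i, σ.input i = letter v (i - 2))
    (hheap : ∀ x y z, σ.heap x y z = if x = 0 ∧ y = 1 ∧ z < 30 then letter v z else 0) :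
    Meets (32 * v.length) B mainCmd σ (400 * (k * v.length ^ 3)) fun τ => τ.reg rAcc = RP v := by
  have hsmall := hB.small
  have hn := hB.n_pos
  have hk := hB.k_pos
  refine (Meets.seq (c₁ := setup) (T₁ := 6)
    (Q₁ := fun τ => τ.heap = σ.heap ∧ Env v.length k τ) ?_ fun σ₁ _ e1 ⟨g1, E1⟩ => Meets.seq
    (copyIn_meets hB E1 (by rwa [e1]) (by rwa [g1])) fun σ₂ a2 _ g2 => ?_).mono
    (T := 6 + ((v.length * (9 + 4) + 3) + ((k * (7 + 4) + 3) +
      ((1 + (v.length * (k * (19 + 4) + 16 + 4) + 3)) +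
      (((v.length + 1) * (k * (18 + 4) + 8 + 4) + 3) +
      (((v.length - 1) * ((v.length + 1) * (k * ((v.length + 1) * (21 + 4) + 10 + 4) + 3 + 4) +
        5 + 4) + 3) + ((v.length + 1) * (k * (13 + 4) + 9 + 4) + 7))))))) ?_ fun _ h => h
  · simp only [setup, Meets, Safe, cost, ev, State.set_reg, State.set_heap, reduceCtorEq, if_true,
      if_false, hN]
    refine ⟨⟨by omega, by omega, by omega, by omega, by omega, trivial⟩, by omega, trivial, ?_⟩
    constructor <;> simp [hN, hK]
  · have E2 := E1.of_agreeOff a2 (by decide)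
    refine Meets.seq (deadRow_meets hB E2 g2) fun σ₃ a3 _ g3 => ?_
    have E3 := E2.of_agreeOff a3 (by decide)
    refine Meets.seq (table_meets hB E3 g3) fun σ₄ a4 _ g4 => ?_
    have E4 := E3.of_agreeOff a4 (by decide)
    have hzero : ∀ l ≤ v.length, ∀ y z, σ₄.heap (l + 1) y z = 0 := fun l hl y z => by
      rw [g4, tableHeap, if_neg (by omega), if_neg (by omega)]
    refine Meets.seq (shortWalks_meets hB E4 (fun s hs a ha => by
      rw [g4]; exact tableHeap_table ⟨hs, ha⟩) hzero) fun σ₅ a5 _ ⟨g5, g6, g7⟩ => ?_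
    have E5 := E4.of_agreeOff a5 (by decide)
    refine Meets.seq (longWalks_meets hB E5 g5 g6 g7) fun σ₆ a6 _ ⟨g8, g9⟩ => ?_
    exact result_meets hB (E5.of_agreeOff a6 (by decide)) g8 g9
  · generalize v.length = n at hn
    have h1 : (n - 1) * ((n + 1) * (k * ((n + 1) * (21 + 4) + 10 + 4) + 3 + 4) + 5 + 4) ≤
        n * ((n + 1) * (k * ((n + 1) * (21 + 4) + 10 + 4) + 3 + 4) + 5 + 4) :=
      Nat.mul_le_mul_right _ (Nat.sub_le _ _)
    have m1 : 1 ≤ k * n := Nat.mul_pos hk hn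
    have m2 : k * n ≤ k * n * n := Nat.le_mul_of_pos_right _ hn
    have m3 : k * n * n ≤ k * n * n * n := Nat.le_mul_of_pos_right _ hn
    have m4 : n ≤ k * n := Nat.le_mul_of_pos_left _ hk
    have m5 : k ≤ k * n := Nat.le_mul_of_pos_right _ hn
    have m6 : n * n ≤ k * n * n := Nat.mul_le_mul_right _ m4
    nlinarith

/-! ### The machine program -/

/-- The first instructions. Register `0` is doubled until it holds `M = 32 * n`, which is beyond the
input; then the registers `2, …, 31` are copied to the registers from `M` on, which are the cells
`(0, 1, 0), …, (0, 1, 29)` of the array, with register `2` holding the increment `1` as soon as it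
is copied. This frees the registers below `32`. Finally `M`, `n` and `k` are put into the registers
`2`, `4` and `5`; the length `n` is recovered as `M / 32`. -/
def relocation : Program :=
  List.replicate 5 (.add 0 0 0) ++ [.store 0 2, .const 2 1] ++
    ((List.range 29).flatMap fun j => [.add 0 0 2, .store 0 (j + 3)]) ++
    [.const 3 29, .sub 0 0 3, .copy 2 0, .const 3 32, .div 4 0 3, .copy 5 1]

/-- A program that computes the rank of a word among the palindromic necklaces. -/
def rankProgram : Program :=
  relocation ++ (mainCmd.compile 71 ++ [.copy 0 rAcc.idx])

theorem rankProgram_getElem? {i : ℕ} {c : Instr} (h : relocation[i]? = some c) :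
    rankProgram[i]? = some c := by
  rw [rankProgram, List.getElem?_append_left, h]
  exact (List.getElem?_eq_some_iff.1 h).1

theorem letter_le (v : List (Fin k)) (i : ℕ) : letter v i ≤ k := by
  rw [letter]
  cases h : v[i]? with
  | none => exact Nat.zero_le _
  | some a => exact a.2.le

theorem letter_eq_zero {i : ℕ} (hi : v.length ≤ i) : letter v i = 0 := by
  rw [letter, List.getElem?_eq_none hi]
  rfl

theorem inputMem_add_two (v : List (Fin k)) (i : ℕ) : inputMem v (i + 2) = letter v i := rfl

theorem inputMem_le (hB : Bounds v.length k B) (a : ℕ) : inputMem v a ≤ B := by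
  have hsmall := hB.small
  match a with
  | 0 => change v.length ≤ B; omega
  | 1 => change k ≤ B; omega
  | i + 2 => have := letter_le v i; rw [inputMem_add_two]; omega

/-- The memory after `j + 1` registers have been copied. -/
def relocatedMem (v : List (Fin k)) (j : ℕ) : ℕ → ℕ := fun a =>
  if a = 0 then 32 * v.length + j else if a = 2 then 1
  else if 32 * v.length ≤ a ∧ a ≤ 32 * v.length + j then letter v (a - 32 * v.length)
  else inputMem v a

theorem relocatedMem_le (hB : Bounds v.length k B) {j : ℕ} (hj : j ≤ 29) (a : ℕ) :
    relocatedMem v j a ≤ B := by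
  have hsmall := hB.small
  have hn := hB.n_pos
  rw [relocatedMem]
  split_ifs
  · omega
  · omega
  · have := letter_le v (a - 32 * v.length)
    omega
  · exact inputMem_le hB a

theorem update_le {m : ℕ → ℕ} (h : ∀ a, m a ≤ B) {d c : ℕ} (hc : c ≤ B) (a : ℕ) :
    Function.update m d c a ≤ B := by
  rw [Function.update_apply]
  split_ifs
  · exact hc
  · exact h a

theorem reaches_relocatedMem (hB : Bounds v.length k B) {j : ℕ} (hj : j ≤ 29) :
    Reaches rankProgram B ⟨0, inputMem v⟩ (2 * j + 7) ⟨2 * j + 7, relocatedMem v j⟩ := by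
  have hsmall := hB.small
  have hn := hB.n_pos
  have hin := inputMem_le hB
  induction j with
  | zero =>
    have hdouble : ∀ i ≤ 5, Reaches rankProgram B ⟨0, inputMem v⟩ i
        ⟨i, Function.update (inputMem v) 0 (2 ^ i * v.length)⟩ := by
      intro i hi
      induction i with
      | zero =>
        have : Function.update (inputMem v) 0 (2 ^ 0 * v.length) = inputMem v := by
          rw [pow_zero, one_mul]
          exact Function.update_eq_self 0 (inputMem v)
        rw [this]
        exact Reaches.refl hin
      | succ i ih =>
        have hpow : 2 ^ (i + 1) ≤ 2 ^ 5 := Nat.pow_le_pow_right (by omega) hi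
        have hle : 2 ^ (i + 1) * v.length ≤ B := (Nat.mul_le_mul_right _ hpow).trans (by omega)
        have hle' : 2 ^ i * v.length ≤ B := 
          (Nat.mul_le_mul_right _ (Nat.pow_le_pow_right (by omega) (Nat.le_succ i))).trans hle
        refine (ih (by omega)).trans (Reaches.step (i := .add 0 0 0) (rankProgram_getElem? ?_) ?_
          (update_le hin hle') (update_le hin hle))
        · have hi' : i < 5 := hi
          interval_cases i <;> rfl
        · simp only [Instr.exec, Function.update_self, Function.update_idem]
          rw [← two_mul, ← mul_assoc, ← pow_succ']
    have h5 := hdouble 5 le_rfl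
    have b5 : ∀ a, Function.update (inputMem v) 0 (2 ^ 5 * v.length) a ≤ B :=
      update_le hin (by omega)
    have b6 : ∀ a, Function.update (Function.update (inputMem v) 0 (2 ^ 5 * v.length))
        (2 ^ 5 * v.length) (letter v 0) a ≤ B :=
      update_le b5 (by have := letter_le v 0; omega)
    have b7 := relocatedMem_le hB (j := 0) (by omega)
    refine (h5.trans (Reaches.step (i := .store 0 2) (rankProgram_getElem? rfl) ?_ b5 b6)).trans
      (Reaches.step (i := .const 2 1) (pc := 6) (rankProgram_getElem? rfl) ?_ b6 b7)
    · simp only [Instr.exec, Function.update_self]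
      rfl
    · simp only [Instr.exec, Config.mk.injEq]
      refine ⟨trivial, ?_⟩
      funext a
      simp only [Function.update_apply, relocatedMem]
      by_cases h2 : a = 2
      · simp [h2]
      by_cases h0 : a = 0
      · subst h0
        rw [if_neg h2, if_neg (by omega)]
        simp
      by_cases h1 : a = 2 ^ 5 * v.length
      · rw [if_neg h2, if_pos h1, if_neg h0, if_neg h2, if_pos (by omega)]
        congr 1
        omega
      · rw [if_neg h2, if_neg h1, if_neg h0, if_neg h0, if_neg h2, if_neg (by omega)]
  | succ j ih =>
    have b1 := relocatedMem_le hB (j := j) (by omega)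
    have b2 : ∀ a, Function.update (relocatedMem v j) 0 (32 * v.length + j + 1) a ≤ B :=
      update_le b1 (by omega)
    have b3 := relocatedMem_le hB (j := j + 1) hj
    refine ((ih (by omega)).trans (Reaches.step (i := .add 0 0 2) (rankProgram_getElem? ?_) ?_ b1
      b2)).trans (Reaches.step (i := .store 0 (j + 3)) (pc := 2 * j + 8) (rankProgram_getElem? ?_)
      ?_ b2 b3)
    · have hj' : j < 29 := hj
      interval_cases j <;> rfl
    · simp [Instr.exec, relocatedMem]
    · have hj' : j < 29 := hj
      interval_cases j <;> rfl
    · simp only [Instr.exec, Function.update_self, Config.mk.injEq]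
      refine ⟨by ring, ?_⟩
      have h3 : Function.update (relocatedMem v j) 0 (32 * v.length + j + 1) (j + 3) =
          letter v (j + 1) := by
        rw [Function.update_of_ne (by omega), relocatedMem, if_neg (by omega), if_neg (by omega),
          if_neg (by omega)]
        rfl
      rw [h3]
      funext a
      simp only [Function.update_apply, relocatedMem]
      by_cases h0 : a = 0
      · subst h0
        rw [if_neg (by omega)]
        simp [add_assoc]
      by_cases h1 : a = 32 * v.length + j + 1
      · have h2 : a ≠ 2 := by omega
        rw [if_pos h1, if_neg h0, if_neg h2, if_pos (by omega)]
        congr 1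
        omega
      · rw [if_neg h1, if_neg h0, if_neg h0, if_neg h0]
        by_cases h2 : a = 2
        · simp [h2]
        · rw [if_neg h2, if_neg h2]
          exact if_congr (by omega) rfl rfl

/-- The state in which the structured part of the program starts: the array holds the first `30`
letters, the other letters are in the input area. -/
def initialState (v : List (Fin k)) (m : ℕ → ℕ) : State where
  reg y := m y.idx
  heap x y z := if x = 0 ∧ y = 1 ∧ z < 30 then letter v z else 0
  input i := letter v (i - 2)

theorem reaches_initialState (hB : Bounds v.length k B) :
    ∃ m, Reaches rankProgram B ⟨0, inputMem v⟩ 71 ⟨71, m⟩ ∧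
      Represents (32 * v.length) B m (initialState v m) ∧ m 4 = v.length ∧ m 5 = k := by
  have hsmall := hB.small
  have hn := hB.n_pos
  have h0 : Reaches rankProgram B ⟨0, inputMem v⟩ 65 ⟨65, relocatedMem v 29⟩ :=
    reaches_relocatedMem hB (j := 29) le_rfl
  have b0 := relocatedMem_le hB (j := 29) le_rfl
  generalize hm0 : relocatedMem v 29 = m0 at h0 b0
  obtain ⟨m1, hm1⟩ : ∃ m, m = Function.update m0 3 29 := ⟨_, rfl⟩
  obtain ⟨m2, hm2⟩ : ∃ m, m = Function.update m1 0 (32 * v.length) := ⟨_, rfl⟩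
  obtain ⟨m3, hm3⟩ : ∃ m, m = Function.update m2 2 (32 * v.length) := ⟨_, rfl⟩
  obtain ⟨m4, hm4⟩ : ∃ m, m = Function.update m3 3 32 := ⟨_, rfl⟩
  obtain ⟨m5, hm5⟩ : ∃ m, m = Function.update m4 4 v.length := ⟨_, rfl⟩
  obtain ⟨m6, hm6⟩ : ∃ m, m = Function.update m5 5 k := ⟨_, rfl⟩
  have b1 : ∀ a, m1 a ≤ B := hm1 ▸ update_le b0 (by omega)
  have b2 : ∀ a, m2 a ≤ B := hm2 ▸ update_le b1 (by omega)
  have b3 : ∀ a, m3 a ≤ B := hm3 ▸ update_le b2 (by omega)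
  have b4 : ∀ a, m4 a ≤ B := hm4 ▸ update_le b3 (by omega)
  have b5 : ∀ a, m5 a ≤ B := hm5 ▸ update_le b4 (by omega)
  have b6 : ∀ a, m6 a ≤ B := hm6 ▸ update_le b5 (by omega)
  have e1 : m0 1 = k := by
    rw [← hm0, relocatedMem, if_neg (by omega), if_neg (by omega), if_neg (by omega)]
    rfl
  have e0 : m0 0 = 32 * v.length + 29 := hm0 ▸ if_pos rfl
  have s1 := Reaches.step (P := rankProgram) (pc := 65) (m := m0) (c' := ⟨66, m1⟩)
    (i := .const 3 29) (rankProgram_getElem? rfl) (by simp [Instr.exec, hm1]) b0 b1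
  have s2 := Reaches.step (P := rankProgram) (pc := 66) (m := m1) (c' := ⟨67, m2⟩) (i := .sub 0 0 3)
    (rankProgram_getElem? rfl) (by simp [Instr.exec, hm2, hm1, e0]) b1 b2
  have s3 := Reaches.step (P := rankProgram) (pc := 67) (m := m2) (c' := ⟨68, m3⟩) (i := .copy 2 0)
    (rankProgram_getElem? rfl) (by simp [Instr.exec, hm3, hm2]) b2 b3
  have s4 := Reaches.step (P := rankProgram) (pc := 68) (m := m3) (c' := ⟨69, m4⟩)
    (i := .const 3 32) (rankProgram_getElem? rfl) (by simp [Instr.exec, hm4]) b3 b4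
  have s5 := Reaches.step (P := rankProgram) (pc := 69) (m := m4) (c' := ⟨70, m5⟩) (i := .div 4 0 3)
    (rankProgram_getElem? rfl) (by simp [Instr.exec, hm5, hm4, hm3, hm2]) b4 b5
  have s6 := Reaches.step (P := rankProgram) (pc := 70) (m := m5) (c' := ⟨71, m6⟩) (i := .copy 5 1)
    (rankProgram_getElem? rfl) (by simp [Instr.exec, hm6, hm5, hm4, hm3, hm2, hm1, e1]) b5 b6
  have h6 := h0.trans (s1.trans (s2.trans (s3.trans (s4.trans (s5.trans s6)))))
  refine ⟨m6, h6, ?_,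
    by simp [hm6, hm5], by simp [hm6]⟩
  have hbig : ∀ a, 32 ≤ a → m6 a = relocatedMem v 29 a := by
    intro a ha
    rw [hm0, hm6, hm5, hm4, hm3, hm2, hm1]
    iterate 6 rw [Function.update_of_ne (by omega)]
  refine ⟨by omega, fun y => rfl, by simp [hm6, hm5, hm4, hm3], fun i hi hiM => ?_,
    fun x y z hy hz hxy => ?_, b6⟩
  · obtain ⟨i, rfl⟩ := Nat.exists_eq_add_of_le' (show 2 ≤ i by omega)
    rw [hbig _ hi, relocatedMem, if_neg (by omega), if_neg (by omega), if_neg (by omega)]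
    rfl
  · have hge := base_le_address z hxy (show 32 ≤ 32 * v.length by omega)
    rw [hbig _ (by omega)]
    change _ = if x = 0 ∧ y = 1 ∧ z < 30 then letter v z else 0
    by_cases h1 : x = 0 ∧ y = 1
    · obtain ⟨rfl, rfl⟩ := h1
      rw [show (0 * (32 * v.length) + 1) * (32 * v.length) + z = 32 * v.length + z by ring,
        relocatedMem, if_neg (by omega), if_neg (by omega)]
      by_cases hz' : z < 30
      · rw [if_pos (by omega), if_pos ⟨rfl, rfl, hz'⟩, Nat.add_sub_cancel_left]
      · rw [if_neg (by omega), if_neg (by omega)]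
        obtain ⟨i, hi⟩ := Nat.exists_eq_add_of_le' (show 2 ≤ 32 * v.length + z by omega)
        rw [hi, inputMem_add_two, letter_eq_zero (by omega)]
    · have h2 : 2 ≤ x * (32 * v.length) + y := by
        rcases Nat.eq_zero_or_pos x with rfl | hx
        · omega
        · have : 1 * (32 * v.length) ≤ x * (32 * v.length) := Nat.mul_le_mul_right _ hx
          omega
      have h3 := Nat.mul_le_mul_right (32 * v.length) h2
      rw [if_neg (by omega), relocatedMem, if_neg (by omega), if_neg (by omega), if_neg (by omega)]
      obtain ⟨i, hi⟩ := Nat.exists_eq_add_of_le'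
        (show 2 ≤ (x * (32 * v.length) + y) * (32 * v.length) + z by omega)
      rw [hi, inputMem_add_two, letter_eq_zero (by omega)]

theorem computesWithin_of_reaches {P : Program} {m m' : ℕ → ℕ} {t pc : ℕ}
    (h : Reaches P B ⟨0, m⟩ t ⟨pc, m'⟩) (hpc : P.length ≤ pc) :
    ComputesWithin P m (m' 0) t B := by
  have hrun : run P m t = ⟨pc, m'⟩ := h.1
  refine ⟨by rw [hrun]; exact hpc, by rw [hrun], fun s a => ?_⟩
  rcases le_total s t with hs | hs
  · exact h.2 s hs a
  · obtain ⟨r, rfl⟩ := Nat.exists_eq_add_of_le hs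
    have hfix : step P ⟨pc, m'⟩ = ⟨pc, m'⟩ := by
      simp only [step, List.getElem?_eq_none hpc]
    have : run P m (t + r) = run P m t := by
      rw [run, add_comm, Function.iterate_add_apply, h.1, hrun, Function.iterate_fixed hfix]
    rw [this]
    exact h.2 t le_rfl a

theorem wellFormed_mainCmd : mainCmd.WellFormed = true := by decide

theorem rankProgram_computes (hB : Bounds v.length k B) :
    ∃ t ≤ 500 * (k * v.length ^ 3), ComputesWithin rankProgram (inputMem v) (RP v) t B := by
  have hsmall := hB.small
  obtain ⟨m, hm, hrep, h4, h5⟩ := reaches_initialState hB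
  obtain ⟨hs, hc, hr⟩ := mainCmd_meets hB (σ := initialState v m) h4 h5 (fun _ => rfl)
    fun _ _ _ => rfl
  have hdrop : rankProgram.drop 71 = mainCmd.compile 71 ++ [.copy 0 rAcc.idx] :=
    List.drop_left' (by rfl)
  obtain ⟨m1, hm1, hrep1⟩ := Cmd.simulation (P := rankProgram) (by omega) mainCmd
    wellFormed_mainCmd (hdrop ▸ List.prefix_append _ _) hrep hs
  have hlast : [Instr.copy 0 rAcc.idx] <+: rankProgram.drop (71 + mainCmd.len) := by
    rw [← List.drop_drop, hdrop, ← length_compile mainCmd 71, List.drop_left]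
  have hstep := Reaches.step (getElem?_of_cons_prefix hlast).1 rfl hrep1.bound
    (update_le hrep1.bound (d := 0) (hrep1.bound rAcc.idx))
  have hall := (hm.trans hm1).trans hstep
  refine ⟨71 + mainCmd.cost (initialState v m) + 1, ?_, ?_⟩
  rotate_left
  · have := computesWithin_of_reaches hall (by
      rw [rankProgram, List.length_append, List.length_append, length_compile]
      exact Nat.le_of_eq (by rw [show relocation.length = 71 from rfl]; rfl))
    change ComputesWithin _ _ (m1 rAcc.idx) _ _ at this
    rwa [hrep1.reg, hr] at this
  · have : 1 ≤ k * v.length ^ 3 := Nat.mul_pos hB.k_pos (pow_pos hB.n_pos 3)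
    omega

/-- With `b = (n + 1) * k ^ n ≥ 2`, the addresses are at most `(4 * b) * (32 * b) * (32 * b)`, hence
at most `b ^ 15`. -/
theorem bounds_pow {n C : ℕ} (hn : 1 ≤ n) (hk : 1 ≤ k) (hC : 15 ≤ C) :
    Bounds n k (((n + 1) * k ^ n) ^ C) := by
  have hkn : 1 ≤ k ^ n := Nat.pow_pos hk
  have hk' : k ≤ k ^ n := Nat.le_self_pow (by omega) k
  have h1 : n + 1 ≤ (n + 1) * k ^ n := Nat.le_mul_of_pos_right _ hkn
  have h2 : k ≤ (n + 1) * k ^ n := hk'.trans (Nat.le_mul_of_pos_left _ (by omega))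
  have hcount : 2 * (n + 1) * k ^ n = 2 * ((n + 1) * k ^ n) := by ring
  generalize (n + 1) * k ^ n = b at *
  have hb : 2 ≤ b := by omega
  have hpow : ∀ i, 2 ^ i ≤ b ^ i := fun i => Nat.pow_le_pow_left hb i
  refine ⟨hn, hk, ?_, ?_⟩
  · calc (n + k + 3) * (32 * n) * (32 * n) ≤ (2 ^ 2 * b) * (2 ^ 5 * b) * (2 ^ 5 * b) := by
          gcongr <;> omega
      _ ≤ (b ^ 2 * b) * (b ^ 5 * b) * (b ^ 5 * b) := by gcongr
      _ = b ^ 15 := by ring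
      _ ≤ b ^ C := Nat.pow_le_pow_right (by omega) hC
  · rw [hcount]
    calc 2 * b ≤ b * b := Nat.mul_le_mul_right _ hb
      _ = b ^ 2 := by ring
      _ ≤ b ^ C := Nat.pow_le_pow_right (by omega) (by omega)

end Main

end RAM

theorem mainTheorem3 :
    ∃ (P : RAM.Program) (C : ℕ), ∀ (k n : ℕ), 1 ≤ n → ∀ v : List (Fin k), v.length = n →
      ∃ t : ℕ, (t : ℝ) ≤ C * (k * (n : ℝ) ^ 3 * (1 + Real.log n) ^ 2) ∧
        RAM.ComputesWithin P (RAM.inputMem v) (RP v) t (((n + 1) * k ^ n) ^ C) := by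
  -- The constant `500` bounds the time, and as an exponent it is beyond the `15` that is needed.
  refine ⟨RAM.rankProgram, 500, fun k n hn v hv => ?_⟩
  subst hv
  have hk : 1 ≤ k := (v[0]).pos
  obtain ⟨t, ht, hP⟩ := RAM.rankProgram_computes (RAM.bounds_pow (C := 500) hn hk (by omega))
  refine ⟨t, ?_, hP⟩
  have h1 : (t : ℝ) ≤ 500 * (k * (v.length : ℝ) ^ 3) := by exact_mod_cast ht
  have hlog : 0 ≤ Real.log v.length := Real.log_natCast_nonneg _
  have h2 : (1 : ℝ) ≤ (1 + Real.log v.length) ^ 2 := one_le_pow₀ (by linarith)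
  refine h1.trans (mul_le_mul_of_nonneg_left ?_ (by norm_num))
  exact le_mul_of_one_le_right (by positivity) h2
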